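/- Conventions. An algebraic circuit over $\mathbb{C}$ is a finite directed acyclic graph whose leaves are labelled by variables or complex constants and whose internal nodes are labelled by $+$ or $\times$ (arbitrary fan-in); its size is the number of nodes, and $\operatorname{size}(f)$ is the least size of a circuit computing the polynomial $f$. $\operatorname{Perm}_m$ is the permanent of the generic $m\times m$ matrix. A family $(f_n)$, with $f_n\in\mathbb{C}[x_1,\dots,x_n]$, is in $\mathsf{VNP}$ if there are $k_n\in\mathbb{N}$ and polynomials $g_n(x_1,\dots,x_n,y_1,\dots,y_{k_n})$ with $f_n(x)=\sum_{y\in\{0,1\}^{k_n}}g_n(x,y)$ for all $n$ and a constant $c$ with $k_n,\deg g_n,\operatorname{size}(g_n)\le n^c$ for all large $n$. For a fixed $c$, let $\mathsf{VNP}^{(c)}_{\mathbb{C}}(n,d)$ be the set of $n$-variate complex polynomials $f$ of total degree at most $d$ that can be written as $f(x)=\sum_{y\in\{0,1\}^{k}}g(x,y)$ with $k,\deg g,\operatorname{size}(g)\le n^c$. For $N=\binom{n+d}{n}$, the coefficient vector of an $n$-variate polynomial of degree at most $d$ is a point of $\mathbb{C}^N$, and polynomials $P(x_1,\dots,x_N)$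 are evaluated at it. Theorem. Let $\varepsilon>0$ be a constant, and put $n=n(m)=\lfloor m^{\varepsilon/4}\rfloor$. Call $m$ hard if $\operatorname{size}(\operatorname{Perm}_m)\ge 2^{m^{\varepsilon}}$. (i) There is a constant $c$, depending only on $\varepsilon$, such that for all constants $a,k\in\mathbb{N}$ and every sufficiently large hard $m$ the following holds for $n=n(m)$, every $d\le n$ and $N=\binom{n+d}{n}$: every nonzero polynomial $P(x_1,\dots,x_N)$ over $\mathbb{C}$ of degree at most $N^a$ that vanishes on the coefficient vectors of all polynomials in $\mathsf{VNP}^{(c)}_{\mathbb{C}}(n,d)$ has $\operatorname{size}(P)\ge N^k$. In other words, equations of degree $\operatorname{poly}(N)$ have $\operatorname{size}(P)=N^{\omega(1)}$. (ii) Let $d_m\le n(m)$ and $N_m=\binom{n(m)+d_m}{n(m)}$, let $a$ be a constant, and let $P_m(x_1,\dots,x_{N_m})$ be nonzero polynomials over $\mathbb{C}$ with $\deg P_m\le N_m^a$ for all large $m$. Suppose that for every family $(f_n)$ in $\mathsf{VNP}$ and every sufficiently large hard $m$ with $\deg f_{n(m)}\le d_m$, the polynomial $P_m$ vanishes on the coefficient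 vector of $f_{n(m)}$. Then for every $k$ and every sufficiently large hard $m$, $\operatorname{size}(P_m)\ge N_m^k$; that is, $\operatorname{size}(P_m)=N_m^{\omega(1)}$ along the hard $m$. -/

import Mathlib

namespace VNPEquations

/-- A node of an algebraic circuit that comes after `k` earlier nodes in a topological order: a leaf
labelled by a variable or a constant, or a `+` / `×` gate of arbitrary fan-in whose set of children
consists of earlier nodes. (A gate without children computes the constant `0`, respectively `1`,
just as a leaf does.) -/
inductive Gate (σ : Type*) (K : Type*) (k : ℕ) where
  | var (x : σ)
  | const (a : K)
  | add (children : Finset (Fin k))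
  | mul (children : Finset (Fin k))

/-- An algebraic circuit over `K` in the variables `σ`: a finite directed acyclic graph, with its
nodes listed in a topological order, and a designated output node. `size` is the number of nodes. -/
structure Circuit (σ : Type*) (K : Type*) where
  size : ℕ
  gate : (i : Fin size) → Gate σ K i
  output : Fin size

/-- The polynomial computed at a node. -/
noncomputable def Circuit.value {σ K : Type*} [CommRing K] (C : Circuit σ K) (i : Fin C.size) :
    MvPolynomial σ K :=
  match C.gate i with
  | .var x => MvPolynomial.X x
  | .const a => MvPolynomial.C a
  | .add S => ∑ j ∈ S, C.value ⟨j, j.isLt.trans i.isLt⟩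
  | .mul S => ∏ j ∈ S, C.value ⟨j, j.isLt.trans i.isLt⟩
termination_by i.val

/-- The circuit computes the polynomial `f`. -/
def Circuit.Computes {σ K : Type*} [CommRing K] (C : Circuit σ K) (f : MvPolynomial σ K) : Prop :=
  C.value C.output = f

/-- `size(f) ≤ s`. -/
def HasCircuitOfSize {σ K : Type*} [CommRing K] (f : MvPolynomial σ K) (s : ℕ) : Prop :=
  ∃ C : Circuit σ K, C.Computes f ∧ C.size ≤ s

/-- `size(f) ≥ s`: every circuit that computes `f` has at least `s` nodes. -/
def RequiresSize {σ K : Type*} [CommRing K] (f : MvPolynomial σ K) (s : ℝ) : Prop :=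
  ∀ C : Circuit σ K, C.Computes f → s ≤ (C.size : ℝ)

/-- The permanent of the generic `m × m` matrix, a polynomial in `m ^ 2` variables. -/
noncomputable def permPoly (K : Type*) [CommRing K] (m : ℕ) : MvPolynomial (Fin m × Fin m) K :=
  (Matrix.mvPolynomialX (Fin m) (Fin m) K).permanent

/-- The exponential sum `∑_{b ∈ {0,1}^k} g(x, b)`. -/
noncomputable def boolSum {K : Type*} [CommRing K] {n k : ℕ}
    (g : MvPolynomial (Fin n ⊕ Fin k) K) : MvPolynomial (Fin n) K :=
  ∑ b : Fin k → Bool,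
    MvPolynomial.aeval (Sum.elim MvPolynomial.X (fun j => if b j then 1 else 0)) g

/-- The family `(f_n)` is in `VP`: degree and circuit size are at most `n ^ c` for large `n`. -/
def MemVP {K : Type*} [CommRing K] {σ : ℕ → Type} (f : (n : ℕ) → MvPolynomial (σ n) K) : Prop :=
  ∃ c : ℕ, ∀ᶠ n in Filter.atTop, (f n).totalDegree ≤ n ^ c ∧ HasCircuitOfSize (f n) (n ^ c)

/-- The family `(f_n)`, with `f_n` an `n`-variate polynomial, is in `VNP`. -/
def MemVNP {K : Type*} [CommRing K] (f : (n : ℕ) → MvPolynomial (Fin n) K) : Prop :=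
  ∃ (k : ℕ → ℕ) (g : (n : ℕ) → MvPolynomial (Fin n ⊕ Fin (k n)) K),
    MemVP g ∧ (∃ c : ℕ, ∀ᶠ n in Filter.atTop, k n ≤ n ^ c) ∧ ∀ n, f n = boolSum (g n)

/-- The polynomials in `VNP(n, d)` with polynomial bound `n ^ c`: the `n`-variate polynomials of
total degree at most `d` that are exponential sums over at most `n ^ c` auxiliary variables of a
polynomial whose degree and circuit size are at most `n ^ c`. -/
def VNPSlice (K : Type*) [CommRing K] (c n d : ℕ) : Set (MvPolynomial (Fin n) K) :=
  {f | f.totalDegree ≤ d ∧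
    ∃ (k : ℕ) (g : MvPolynomial (Fin n ⊕ Fin k) K),
      k ≤ n ^ c ∧ g.totalDegree ≤ n ^ c ∧ HasCircuitOfSize g (n ^ c) ∧ f = boolSum g}

/-- The exponent vectors of the monomials in `n` variables of total degree at most `d`; there are
`(n + d).choose n` of them. -/
abbrev MonIdx (n d : ℕ) : Type := {e : Fin n →₀ ℕ // e.degree ≤ d}

/-- The coefficient vector of an `n`-variate polynomial of degree at most `d`. -/
def coeffVec {K : Type*} [CommRing K] {n : ℕ} (d : ℕ) (f : MvPolynomial (Fin n) K) :
    MonIdx n d → K :=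
  fun e => f.coeff e.1

/-- `P` vanishes at the coefficient vector of `f`. -/
def VanishesAt {K : Type*} [CommRing K] {n d : ℕ} (P : MvPolynomial (MonIdx n d) K)
    (f : MvPolynomial (Fin n) K) : Prop :=
  MvPolynomial.eval (coeffVec d f) P = 0

/-- `Perm_m` over `ℂ` requires circuits of size `2 ^ (m ^ ε)`. -/
def PermHard (ε : ℝ) (m : ℕ) : Prop :=
  RequiresSize (permPoly ℂ m) ((2 : ℝ) ^ ((m : ℝ) ^ ε))

/-- The number of variables `n = m ^ (ε / 4)`, rounded down. -/
noncomputable def numVars (ε : ℝ) (m : ℕ) : ℕ := ⌊(m : ℝ) ^ (ε / 4)⌋₊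

end VNPEquations

/-! An equation with a small circuit would give a small circuit for the permanent. The coefficient
vectors to test are those of a Kabanets–Impagliazzo generator with `Perm_m` as the hard polynomial:
the coefficient at the exponent vector e is the permanent of the matrix whose (i, j) entry is read
from an arbitrary table `α i j` at the place ∑ e_l c(i,j)^l in `ZMod q`. Distinct exponent vectors
are distinct polynomials of degree less than n, so they read the same place at no more than n of the
m² positions (`card_agree_le`).

For every table this vector comes from `VNP` (`exists_mem_VNPSlice`). Encode e by indicator bits.
Expanding the table in additive characters of `ZMod q` turns each entry into a short sum of products
of linear forms in these bits, and Ryser's formula writes the permanent as an exponential sum over m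
further bits.

So P vanishes on the whole generator. Replace its free coordinates by these permanents one at a
time; at some coordinate e the restriction of P becomes identically zero. Fixing the table entries
that e does not read gives Q ≠ 0 with Q(Perm_m, x) = 0 (`exists_annihilator_of_permanent`). The
other permanents involve at most n variables each, so for fixed a and k the size and degree of Q are
2^{O(n²)}. Newton iteration at a simple root solves for the permanent (`hasCircuitOfSize_root`) in
size 2^{O(n³)}, which is eventually below 2^{n⁴} ≤ 2^{m^ε}, a contradiction.

For families, violations of the slice condition at infinitely many m are glued into one family in
`VNP` (`eventually_vanishesAt_slice`). -/

namespace VNPEquations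

/-! ### Circuits as straight-line programs, and size calculus. -/

section Circuits

open Finset

variable {σ τ ι K : Type*} [CommRing K]

/-- The first `t` terms of `v` are the values of a straight-line program with sum and product
instructions of arbitrary fan-in. -/
def IsStraightLine (v : ℕ → MvPolynomial σ K) (t : ℕ) : Prop :=
  ∀ i < t, (∃ x, v i = MvPolynomial.X x) ∨ (∃ a, v i = MvPolynomial.C a) ∨
    (∃ S : Finset ℕ, (∀ j ∈ S, j < i) ∧ v i = ∑ j ∈ S, v j) ∨
    (∃ S : Finset ℕ, (∀ j ∈ S, j < i) ∧ v i = ∏ j ∈ S, v j)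

theorem Circuit.isStraightLine (C : Circuit σ K) :
    IsStraightLine (fun i => if h : i < C.size then C.value ⟨i, h⟩ else 0) C.size := by
  intro i hi
  simp only [hi, dif_pos]
  rw [Circuit.value]
  cases hg : C.gate ⟨i, hi⟩ with
  | var x => exact Or.inl ⟨x, rfl⟩
  | const a => exact Or.inr (Or.inl ⟨a, rfl⟩)
  | add S =>
    refine Or.inr (Or.inr (Or.inl ⟨S.map Fin.valEmbedding, ?_, ?_⟩))
    · simp only [mem_map, Fin.valEmbedding_apply]
      rintro j ⟨k, -, rfl⟩
      exact k.isLt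
    · rw [sum_map]
      refine sum_congr rfl fun j _ => ?_
      have : (j : ℕ) < C.size := j.isLt.trans hi
      simp [this]
  | mul S =>
    refine Or.inr (Or.inr (Or.inr ⟨S.map Fin.valEmbedding, ?_, ?_⟩))
    · simp only [mem_map, Fin.valEmbedding_apply]
      rintro j ⟨k, -, rfl⟩
      exact k.isLt
    · rw [prod_map]
      refine prod_congr rfl fun j _ => ?_
      have : (j : ℕ) < C.size := j.isLt.trans hi
      simp [this]

theorem IsStraightLine.exists_circuit {v : ℕ → MvPolynomial σ K} {t : ℕ}
    (h : IsStraightLine v t) (o : Fin t) :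
    ∃ C : Circuit σ K, C.size = t ∧ C.Computes (v o) := by
  have key : ∀ i : Fin t, ∃ g : Gate σ K i,
      (match g with
        | .var x => MvPolynomial.X x
        | .const a => MvPolynomial.C a
        | .add S => ∑ j ∈ S, v j
        | .mul S => ∏ j ∈ S, v j) = v i := by
    intro i
    rcases h i i.isLt with ⟨x, hx⟩ | ⟨a, ha⟩ | ⟨S, hS, hv⟩ | ⟨S, hS, hv⟩
    · exact ⟨.var x, hx.symm⟩
    · exact ⟨.const a, ha.symm⟩
    · refine ⟨.add (S.attachFin hS), ?_⟩
      rw [hv]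
      conv_rhs => rw [← map_valEmbedding_attachFin hS, sum_map]
      rfl
    · refine ⟨.mul (S.attachFin hS), ?_⟩
      rw [hv]
      conv_rhs => rw [← map_valEmbedding_attachFin hS, prod_map]
      rfl
  choose g hg using key
  refine ⟨⟨t, g, o⟩, rfl, ?_⟩
  have hval : ∀ (i : ℕ) (hi : i < t), Circuit.value ⟨t, g, o⟩ ⟨i, hi⟩ = v i := by
    intro i
    induction i using Nat.strong_induction_on with
    | _ i ih =>
      intro hi
      rw [Circuit.value, ← hg ⟨i, hi⟩]
      dsimp only
      cases g ⟨i, hi⟩ with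
      | var x => rfl
      | const a => rfl
      | add S => exact sum_congr rfl fun j _ => ih j j.isLt _
      | mul S => exact prod_congr rfl fun j _ => ih j j.isLt _
  exact hval o o.isLt

/-- Programs indexed by ℕ can be concatenated by shifting indices, with no transport of the
dependent gate types of `Circuit`. -/
theorem hasCircuitOfSize_iff {f : MvPolynomial σ K} {s : ℕ} :
    HasCircuitOfSize f s ↔ ∃ (v : ℕ → MvPolynomial σ K) (t : ℕ), IsStraightLine v t ∧ t ≤ s ∧
      ∃ i < t, v i = f := by
  constructor
  · rintro ⟨C, hC, hs⟩
    refine ⟨_, C.size, C.isStraightLine, hs, C.output, C.output.isLt, ?_⟩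
    simpa [Circuit.Computes] using hC
  · rintro ⟨v, t, hv, hts, i, hi, rfl⟩
    obtain ⟨C, rfl, hC⟩ := hv.exists_circuit ⟨i, hi⟩
    exact ⟨C, hC, hts⟩

theorem HasCircuitOfSize.mono {f : MvPolynomial σ K} {s t : ℕ} (h : HasCircuitOfSize f s)
    (hst : s ≤ t) : HasCircuitOfSize f t := by
  obtain ⟨C, hC, hs⟩ := h
  exact ⟨C, hC, hs.trans hst⟩

/-- Run the program `w` after the first `t` instructions of `v`. -/
def appendProg {A : Type*} (v : ℕ → A) (t : ℕ) (w : ℕ → A) : ℕ → A :=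
  fun i => if i < t then v i else w (i - t)

theorem appendProg_of_lt {A : Type*} {v w : ℕ → A} {t i : ℕ} (h : i < t) :
    appendProg v t w i = v i := if_pos h

theorem appendProg_add {A : Type*} {v w : ℕ → A} {t i : ℕ} :
    appendProg v t w (i + t) = w i := by
  simp [appendProg]

theorem appendProg_self {A : Type*} {v w : ℕ → A} {t : ℕ} :
    appendProg v t w t = w 0 := by
  simp [appendProg]

/-- Append to a program `v` over the variables `τ` the image of a program `w` over the variables
`σ` under a substitution whose values are computed by `v`. -/
theorem IsStraightLine.append_subst {v : ℕ → MvPolynomial τ K} {w : ℕ → MvPolynomial σ K}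
    {t s : ℕ} (hv : IsStraightLine v t) (hw : IsStraightLine w s) (g : σ → MvPolynomial τ K)
    (hg : ∀ x, (∃ y, g x = MvPolynomial.X y) ∨ ∃ j < t, v j = g x) :
    IsStraightLine (appendProg v t fun i => MvPolynomial.aeval g (w i)) (t + s) := by
  intro i hi
  by_cases hit : i < t
  · rw [appendProg_of_lt hit]
    rcases hv i hit with h | h | ⟨S, hS, h⟩ | ⟨S, hS, h⟩
    · exact Or.inl h
    · exact Or.inr (Or.inl h)
    · refine Or.inr (Or.inr (Or.inl ⟨S, hS, h.trans (sum_congr rfl fun j hj => ?_)⟩))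
      rw [appendProg_of_lt ((hS j hj).trans hit)]
    · refine Or.inr (Or.inr (Or.inr ⟨S, hS, h.trans (prod_congr rfl fun j hj => ?_)⟩))
      rw [appendProg_of_lt ((hS j hj).trans hit)]
  · obtain ⟨k, rfl⟩ := Nat.exists_eq_add_of_le' (not_lt.mp hit)
    rw [appendProg_add]
    rcases hw k (by omega) with ⟨x, h⟩ | ⟨a, h⟩ | ⟨S, hS, h⟩ | ⟨S, hS, h⟩
    · rw [h, MvPolynomial.aeval_X]
      rcases hg x with ⟨y, hy⟩ | ⟨j, hj, hjx⟩
      · exact Or.inl ⟨y, hy⟩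
      -- A variable whose substitute is already computed becomes a one-term sum gate, so the length
      -- is exactly `t + s`.
      · refine Or.inr (Or.inr (Or.inl ⟨{j}, ?_, ?_⟩))
        · simp only [mem_singleton, forall_eq]; omega
        · rw [sum_singleton, appendProg_of_lt hj, hjx]
    · exact Or.inr (Or.inl ⟨a, by rw [h]; simp [MvPolynomial.algebraMap_eq]⟩)
    · refine Or.inr (Or.inr (Or.inl ⟨S.map (addRightEmbedding t), ?_, ?_⟩))
      · simp only [mem_map, addRightEmbedding_apply]
        rintro _ ⟨j, hj, rfl⟩
        have := hS j hj
        omega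
      · rw [h, sum_map, map_sum]
        simp only [addRightEmbedding_apply, appendProg_add]
    · refine Or.inr (Or.inr (Or.inr ⟨S.map (addRightEmbedding t), ?_, ?_⟩))
      · simp only [mem_map, addRightEmbedding_apply]
        rintro _ ⟨j, hj, rfl⟩
        have := hS j hj
        omega
      · rw [h, prod_map, map_prod]
        simp only [addRightEmbedding_apply, appendProg_add]

theorem IsStraightLine.append {v w : ℕ → MvPolynomial σ K} {t s : ℕ}
    (hv : IsStraightLine v t) (hw : IsStraightLine w s) :
    IsStraightLine (appendProg v t w) (t + s) := by
  simpa using hv.append_subst hw MvPolynomial.X fun x => Or.inl ⟨x, rfl⟩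

/-- The programs are concatenated without sharing. Injectivity of `idx` matters because the children
of a gate form a `Finset`: equal summands or factors need separate nodes, or they would be counted
once. -/
theorem exists_joint_program (S : Finset ι) (f : ι → MvPolynomial σ K) (s : ι → ℕ)
    (h : ∀ i ∈ S, HasCircuitOfSize (f i) (s i)) :
    ∃ (v : ℕ → MvPolynomial σ K) (t : ℕ) (idx : ι → ℕ), IsStraightLine v t ∧
      t ≤ ∑ i ∈ S, s i ∧ (∀ i ∈ S, idx i < t ∧ v (idx i) = f i) ∧ Set.InjOn idx S := by
  classical
  induction S using Finset.induction_on with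
  | empty => exact ⟨0, 0, 0, fun i hi => absurd hi (Nat.not_lt_zero i), by simp⟩
  | insert a S ha ih =>
    obtain ⟨v, t, idx, hv, ht, hidx, hinj⟩ := ih fun i hi => h i (mem_insert_of_mem hi)
    obtain ⟨w, r, hw, hr, o, ho, hof⟩ := hasCircuitOfSize_iff.mp (h a (mem_insert_self a S))
    have hne : ∀ i ∈ S, i ≠ a := fun i hi e => ha (e ▸ hi)
    refine ⟨appendProg v t w, t + r, fun i => if i = a then o + t else idx i,
      hv.append hw, ?_, ?_, ?_⟩
    · rw [sum_insert ha]; omega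
    · intro i hi
      rcases mem_insert.mp hi with rfl | hi
      · simp only [if_true, appendProg_add]
        exact ⟨by omega, hof⟩
      · simp only [hne i hi, if_false]
        rw [appendProg_of_lt (hidx i hi).1]
        exact ⟨by have := (hidx i hi).1; omega, (hidx i hi).2⟩
    · intro i hi j hj hij
      rw [mem_coe] at hi hj
      rcases mem_insert.mp hi with hi | hi <;> rcases mem_insert.mp hj with hj | hj
      · exact hi.trans hj.symm
      · simp only [hi, if_true, hne j hj, if_false] at hij
        have := (hidx j hj).1; omega
      · simp only [hj, if_true, hne i hi, if_false] at hij
        have := (hidx i hi).1; omega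
      · simp only [hne i hi, hne j hj, if_false] at hij
        exact hinj hi hj hij

theorem IsStraightLine.snoc {v : ℕ → MvPolynomial σ K} {t : ℕ} (hv : IsStraightLine v t)
    {f : MvPolynomial σ K}
    (hf : (∃ S : Finset ℕ, (∀ j ∈ S, j < t) ∧ f = ∑ j ∈ S, v j) ∨
      (∃ S : Finset ℕ, (∀ j ∈ S, j < t) ∧ f = ∏ j ∈ S, v j)) :
    HasCircuitOfSize f (t + 1) := by
  refine hasCircuitOfSize_iff.mpr ⟨appendProg v t fun _ => f, t + 1, ?_, le_rfl, t,
    Nat.lt_succ_self t, appendProg_self⟩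
  intro i hi
  rcases Nat.lt_succ_iff_lt_or_eq.mp hi with hit | rfl
  · have h0 : IsStraightLine (appendProg v t fun _ => f) (t + 0) :=
      hv.append fun i hi => absurd hi (Nat.not_lt_zero i)
    exact h0 i hit
  · rw [appendProg_self]
    rcases hf with ⟨S, hS, h⟩ | ⟨S, hS, h⟩
    · refine Or.inr (Or.inr (Or.inl ⟨S, hS, h.trans (sum_congr rfl fun j hj => ?_)⟩))
      rw [appendProg_of_lt (hS j hj)]
    · refine Or.inr (Or.inr (Or.inr ⟨S, hS, h.trans (prod_congr rfl fun j hj => ?_)⟩))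
      rw [appendProg_of_lt (hS j hj)]

theorem hasCircuitOfSize_X (x : σ) : HasCircuitOfSize (MvPolynomial.X x : MvPolynomial σ K) 1 :=
  hasCircuitOfSize_iff.mpr
    ⟨fun _ => MvPolynomial.X x, 1, fun _ _ => Or.inl ⟨x, rfl⟩, le_rfl, 0, one_pos, rfl⟩

theorem hasCircuitOfSize_C (a : K) : HasCircuitOfSize (MvPolynomial.C a : MvPolynomial σ K) 1 :=
  hasCircuitOfSize_iff.mpr
    ⟨fun _ => MvPolynomial.C a, 1, fun _ _ => Or.inr (Or.inl ⟨a, rfl⟩), le_rfl, 0, one_pos, rfl⟩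

theorem HasCircuitOfSize.sum {S : Finset ι} {f : ι → MvPolynomial σ K} {s : ι → ℕ}
    (h : ∀ i ∈ S, HasCircuitOfSize (f i) (s i)) :
    HasCircuitOfSize (∑ i ∈ S, f i) (∑ i ∈ S, s i + 1) := by
  obtain ⟨v, t, idx, hv, ht, hidx, hinj⟩ := exists_joint_program S f s h
  refine (hv.snoc (Or.inl ⟨S.image idx, ?_, ?_⟩)).mono (Nat.succ_le_succ ht)
  · simp only [mem_image]
    rintro _ ⟨i, hi, rfl⟩
    exact (hidx i hi).1
  · rw [sum_image hinj]
    exact sum_congr rfl fun i hi => (hidx i hi).2.symm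

theorem HasCircuitOfSize.prod {S : Finset ι} {f : ι → MvPolynomial σ K} {s : ι → ℕ}
    (h : ∀ i ∈ S, HasCircuitOfSize (f i) (s i)) :
    HasCircuitOfSize (∏ i ∈ S, f i) (∑ i ∈ S, s i + 1) := by
  obtain ⟨v, t, idx, hv, ht, hidx, hinj⟩ := exists_joint_program S f s h
  refine (hv.snoc (Or.inr ⟨S.image idx, ?_, ?_⟩)).mono (Nat.succ_le_succ ht)
  · simp only [mem_image]
    rintro _ ⟨i, hi, rfl⟩
    exact (hidx i hi).1
  · rw [prod_image hinj]
    exact prod_congr rfl fun i hi => (hidx i hi).2.symm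

theorem HasCircuitOfSize.sum_const {S : Finset ι} {f : ι → MvPolynomial σ K} {s : ℕ}
    (h : ∀ i ∈ S, HasCircuitOfSize (f i) s) :
    HasCircuitOfSize (∑ i ∈ S, f i) (#S * s + 1) := by
  simpa using HasCircuitOfSize.sum (s := fun _ => s) h

theorem HasCircuitOfSize.prod_const {S : Finset ι} {f : ι → MvPolynomial σ K} {s : ℕ}
    (h : ∀ i ∈ S, HasCircuitOfSize (f i) s) :
    HasCircuitOfSize (∏ i ∈ S, f i) (#S * s + 1) := by
  simpa using HasCircuitOfSize.prod (s := fun _ => s) h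

theorem HasCircuitOfSize.add {f g : MvPolynomial σ K} {s t : ℕ} (hf : HasCircuitOfSize f s)
    (hg : HasCircuitOfSize g t) : HasCircuitOfSize (f + g) (s + t + 1) := by
  simpa using HasCircuitOfSize.sum (S := (univ : Finset (Fin 2))) (f := ![f, g]) (s := ![s, t])
    (by simp [Fin.forall_fin_two, hf, hg])

theorem HasCircuitOfSize.mul {f g : MvPolynomial σ K} {s t : ℕ} (hf : HasCircuitOfSize f s)
    (hg : HasCircuitOfSize g t) : HasCircuitOfSize (f * g) (s + t + 1) := by
  simpa using HasCircuitOfSize.prod (S := (univ : Finset (Fin 2))) (f := ![f, g]) (s := ![s, t])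
    (by simp [Fin.forall_fin_two, hf, hg])

theorem HasCircuitOfSize.pow {f : MvPolynomial σ K} {s : ℕ} (hf : HasCircuitOfSize f s) (k : ℕ) :
    HasCircuitOfSize (f ^ k) (k * s + 1) := by
  simpa using HasCircuitOfSize.prod_const (S := range k) (f := fun _ => f) fun _ _ => hf

theorem HasCircuitOfSize.C_mul {f : MvPolynomial σ K} {s : ℕ} (hf : HasCircuitOfSize f s) (a : K) :
    HasCircuitOfSize (MvPolynomial.C a * f) (s + 2) :=
  ((hasCircuitOfSize_C a).mul hf).mono (by omega)

theorem HasCircuitOfSize.sub {f g : MvPolynomial σ K} {s t : ℕ} (hf : HasCircuitOfSize f s)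
    (hg : HasCircuitOfSize g t) : HasCircuitOfSize (f - g) (s + t + 3) := by
  have := hf.add (hg.C_mul (-1))
  simp only [map_neg, map_one, neg_mul, one_mul, ← sub_eq_add_neg] at this
  exact this.mono (by omega)

/-- Substituting polynomials for the variables adds up the sizes. -/
theorem HasCircuitOfSize.aeval [Fintype σ] {f : MvPolynomial σ K} {s : ℕ}
    (hf : HasCircuitOfSize f s) {g : σ → MvPolynomial τ K} {t : σ → ℕ}
    (hg : ∀ x, HasCircuitOfSize (g x) (t x)) :
    HasCircuitOfSize (MvPolynomial.aeval g f) (∑ x, t x + s) := by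
  obtain ⟨w, r, hw, hr, o, ho, hof⟩ := hasCircuitOfSize_iff.mp hf
  obtain ⟨v, u, idx, hv, hu, hidx, -⟩ := exists_joint_program univ g t fun x _ => hg x
  refine hasCircuitOfSize_iff.mpr ⟨_, u + r, hv.append_subst hw g fun x => Or.inr
    ⟨idx x, (hidx x (mem_univ x)).1, (hidx x (mem_univ x)).2⟩, by omega, o + u, by omega, ?_⟩
  rw [appendProg_add, hof]

end Circuits

/-! ### Degrees under substitution. -/

section Degrees

open Finset

variable {σ τ K : Type*} [CommRing K]

theorem totalDegree_aeval_le {f : MvPolynomial σ K} {D B : ℕ} (hf : f.totalDegree ≤ D)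
    {g : σ → MvPolynomial τ K} (hg : ∀ x, (g x).totalDegree ≤ B) :
    (MvPolynomial.aeval g f).totalDegree ≤ D * B := by
  rw [MvPolynomial.aeval_def, MvPolynomial.eval₂_eq]
  refine MvPolynomial.totalDegree_finsetSum_le fun d hd => ?_
  refine (MvPolynomial.totalDegree_mul _ _).trans ?_
  rw [MvPolynomial.algebraMap_eq, MvPolynomial.totalDegree_C, zero_add]
  refine (MvPolynomial.totalDegree_finsetProd _ _).trans ?_
  calc ∑ i ∈ d.support, (g i ^ d i).totalDegree ≤ ∑ i ∈ d.support, d i * B :=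
        sum_le_sum fun i _ => (MvPolynomial.totalDegree_pow _ _).trans
          (Nat.mul_le_mul_left _ (hg i))
    _ = (∑ i ∈ d.support, d i) * B := (sum_mul _ _ _).symm
    _ ≤ D * B := Nat.mul_le_mul_right _ ((MvPolynomial.le_totalDegree hd).trans hf)

theorem natDegree_aeval_le {R : Type*} [CommRing R] [Algebra K R] {f : MvPolynomial σ K} {D : ℕ}
    (hf : f.totalDegree ≤ D) {g : σ → Polynomial R} (hg : ∀ x, (g x).natDegree ≤ 1) :
    (MvPolynomial.aeval g f).natDegree ≤ D := by
  rw [MvPolynomial.aeval_def, MvPolynomial.eval₂_eq]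
  refine Polynomial.natDegree_sum_le_of_forall_le _ _ fun d hd => ?_
  refine Polynomial.natDegree_mul_le.trans ?_
  rw [Polynomial.algebraMap_apply, Polynomial.natDegree_C, zero_add]
  refine (Polynomial.natDegree_prod_le _ _).trans ?_
  calc ∑ i ∈ d.support, (g i ^ d i).natDegree ≤ ∑ i ∈ d.support, d i :=
        sum_le_sum fun i _ => Polynomial.natDegree_pow_le.trans
          ((Nat.mul_le_mul_left _ (hg i)).trans (mul_one _).le)
    _ ≤ D := (MvPolynomial.le_totalDegree hd).trans hf

end Degrees

/-! ### Extracting coefficients by Lagrange interpolation. -/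

section Interpolation

open Finset Polynomial

/-- A coefficient of a polynomial of degree at most `D` is a fixed linear combination of the values
at `0, …, D`, over all `ℂ`-algebras at once. -/
theorem exists_coeff_eq_sum_eval (D i : ℕ) : ∃ w : ℕ → ℂ, ∀ {R : Type*} [CommRing R] [Algebra ℂ R]
    (q : R[X]), q.natDegree ≤ D →
      q.coeff i = ∑ l ∈ range (D + 1), algebraMap ℂ R (w l) * q.eval (l : R) := by
  -- The nodes are distinct in ℂ. Interpolating the powers X^k there gives numerical identities for
  -- these weights, which then map to every ℂ-algebra.
  refine ⟨fun l => (Lagrange.basis (range (D + 1)) (fun l : ℕ => (l : ℂ)) l).coeff i, ?_⟩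
  intro R _ _ q hq
  have hinj : Set.InjOn (fun l : ℕ => (l : ℂ)) (range (D + 1)) := Nat.cast_injective.injOn
  have hpow : ∀ k ∈ range (D + 1), ∑ l ∈ range (D + 1),
      (Lagrange.basis (range (D + 1)) (fun l : ℕ => (l : ℂ)) l).coeff i * (l : ℂ) ^ k =
        if i = k then 1 else 0 := by
    intro k hk
    have h := Lagrange.eq_interpolate (s := range (D + 1)) (v := fun l : ℕ => (l : ℂ))
      (f := (X : ℂ[X]) ^ k) hinj (by
        rw [degree_X_pow, card_range]; exact_mod_cast mem_range.mp hk)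
    have h2 := congrArg (fun f => coeff f i) h
    simp only [Lagrange.interpolate_apply, coeff_X_pow, finsetSum_coeff, coeff_C_mul, eval_pow,
      eval_X] at h2
    rw [h2]
    exact sum_congr rfl fun l _ => mul_comm _ _
  have hev : ∀ x : R, q.eval x = ∑ k ∈ range (D + 1), q.coeff k * x ^ k :=
    fun x => eval_eq_sum_range' (Nat.lt_succ_of_le hq) x
  simp only [hev, mul_sum]
  rw [sum_comm]
  have : ∀ k ∈ range (D + 1), ∑ l ∈ range (D + 1), algebraMap ℂ R
      ((Lagrange.basis (range (D + 1)) (fun l : ℕ => (l : ℂ)) l).coeff i) *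
        (q.coeff k * (l : R) ^ k) = q.coeff k * if i = k then 1 else 0 := by
    intro k hk
    have h := congrArg (algebraMap ℂ R) (hpow k hk)
    rw [map_sum] at h
    simp only [map_mul, map_pow, map_natCast, apply_ite (algebraMap ℂ R), map_one, map_zero] at h
    rw [← h, mul_sum]
    exact sum_congr rfl fun l _ => by ring
  rw [sum_congr rfl this]
  simp only [mul_ite, mul_one, mul_zero, sum_ite_eq, mem_range]
  split_ifs with h
  · rfl
  · exact coeff_eq_zero_of_natDegree_lt (by omega)

end Interpolation

/-! ### Newton iteration: circuits for polynomial roots. -/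

section Root

open Finset Polynomial

variable {τ : Type*}

/-- Substitution of `r` for the distinguished variable. -/
noncomputable def substNone (r : MvPolynomial τ ℂ) :
    MvPolynomial (Option τ) ℂ →ₐ[ℂ] MvPolynomial τ ℂ :=
  MvPolynomial.aeval fun o => o.elim r MvPolynomial.X

theorem eval_optionEquivLeft (Q : MvPolynomial (Option τ) ℂ) (r : MvPolynomial τ ℂ) :
    (MvPolynomial.optionEquivLeft ℂ τ Q).eval r = substNone r Q := by
  have : ((Polynomial.aeval r).restrictScalars ℂ).comp
      (MvPolynomial.optionEquivLeft ℂ τ).toAlgHom = substNone r := by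
    apply MvPolynomial.algHom_ext
    rintro (_ | i) <;> simp [substNone]
  simpa [Polynomial.coe_aeval_eq_eval] using DFunLike.congr_fun this Q

theorem natDegree_optionEquivLeft_le {Q : MvPolynomial (Option τ) ℂ} {D : ℕ}
    (hQ : Q.totalDegree ≤ D) : (MvPolynomial.optionEquivLeft ℂ τ Q).natDegree ≤ D := by
  rw [MvPolynomial.optionEquivLeft_apply]
  refine natDegree_aeval_le hQ ?_
  rintro (_ | i)
  · simp
  · simp

theorem HasCircuitOfSize.substNone [Fintype τ] {Q : MvPolynomial (Option τ) ℂ}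
    {r : MvPolynomial τ ℂ} {s t : ℕ} (hQ : HasCircuitOfSize Q s) (hr : HasCircuitOfSize r t) :
    HasCircuitOfSize (substNone r Q) (t + Fintype.card τ + s) := by
  have := hQ.aeval (g := fun o : Option τ => o.elim r MvPolynomial.X)
    (t := fun o => o.elim t fun _ => 1) (by
      rintro (_ | i)
      · exact hr
      · exact hasCircuitOfSize_X i)
  simpa [Fintype.sum_option, VNPEquations.substNone] using this

theorem totalDegree_substNone_le {Q : MvPolynomial (Option τ) ℂ} {r : MvPolynomial τ ℂ} {D B : ℕ}
    (hQ : Q.totalDegree ≤ D) (hr : r.totalDegree ≤ B) (hB : 1 ≤ B) :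
    (substNone r Q).totalDegree ≤ D * B := by
  refine totalDegree_aeval_le hQ ?_
  rintro (_ | i)
  · exact hr
  · simpa using hB

/-- Hasse derivatives in the distinguished variable have small circuits. -/
theorem exists_hasseDeriv_circuit [Fintype τ] {Q : MvPolynomial (Option τ) ℂ} {D s : ℕ}
    (hD : Q.totalDegree ≤ D) (hs : HasCircuitOfSize Q s) (i : ℕ) :
    ∃ Q' : MvPolynomial (Option τ) ℂ, Q'.totalDegree ≤ D ∧
      HasCircuitOfSize Q' ((D + 1) * (3 * (Fintype.card τ + 1) + s + 2) + 1) ∧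
      ∀ r, substNone r Q' = (hasseDeriv i (MvPolynomial.optionEquivLeft ℂ τ Q)).eval r := by
  obtain ⟨w, hw⟩ := exists_coeff_eq_sum_eval D i
  -- The Hasse derivative at r is a coefficient of the Taylor shift q(X + r). It is interpolated
  -- from the values at X = l, which are those of Q with the distinguished variable shifted by l.
  let g : ℕ → Option τ → MvPolynomial (Option τ) ℂ := fun l o =>
    o.elim (MvPolynomial.X none + MvPolynomial.C (l : ℂ)) fun x => MvPolynomial.X (some x)
  refine ⟨∑ l ∈ range (D + 1), MvPolynomial.C (w l) * MvPolynomial.aeval (g l) Q, ?_, ?_, ?_⟩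
  · refine MvPolynomial.totalDegree_finsetSum_le fun l _ => ?_
    refine (MvPolynomial.totalDegree_mul _ _).trans ?_
    rw [MvPolynomial.totalDegree_C, zero_add, ← mul_one D]
    refine totalDegree_aeval_le hD ?_
    rintro (_ | x)
    · refine (MvPolynomial.totalDegree_add _ _).trans ?_
      rw [MvPolynomial.totalDegree_X, MvPolynomial.totalDegree_C]
      exact le_rfl
    · simp [g]
  · have := HasCircuitOfSize.sum_const (S := range (D + 1))
      (f := fun l => MvPolynomial.C (w l) * MvPolynomial.aeval (g l) Q)
      (s := 3 * (Fintype.card τ + 1) + s + 2) fun l _ => ?_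
    · simpa using this
    · refine HasCircuitOfSize.C_mul ?_ _
      have h := hs.aeval (g := g l) (t := fun _ => 3) (by
        rintro (_ | x)
        · exact (hasCircuitOfSize_X _).add (hasCircuitOfSize_C _)
        · exact (hasCircuitOfSize_X _).mono (by omega))
      refine h.mono ?_
      simp [mul_comm]
  · intro r
    rw [← taylor_coeff, hw _ ((natDegree_taylor _ _).le.trans (natDegree_optionEquivLeft_le hD)),
      map_sum]
    refine sum_congr rfl fun l _ => ?_
    rw [taylor_eval, eval_optionEquivLeft, map_mul]
    congr 1
    · simp [substNone]
    · have : (substNone r).comp (MvPolynomial.aeval (g l)) =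
          substNone ((l : MvPolynomial τ ℂ) + r) := by
        apply MvPolynomial.algHom_ext
        rintro (_ | i) <;> simp [substNone, g, add_comm]
      exact DFunLike.congr_fun this Q

/-- Dilation by a formal factor about the point `z`. -/
noncomputable def dilate (z : τ → ℂ) : MvPolynomial τ ℂ →ₐ[ℂ] (MvPolynomial τ ℂ)[X] :=
  MvPolynomial.aeval fun x =>
    C (MvPolynomial.C (z x)) + X * C (MvPolynomial.X x - MvPolynomial.C (z x))

theorem natDegree_dilate_le {z : τ → ℂ} {f : MvPolynomial τ ℂ} {D : ℕ} (hf : f.totalDegree ≤ D) :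
    (dilate z f).natDegree ≤ D := by
  refine natDegree_aeval_le hf fun x => ?_
  refine (natDegree_add_le _ _).trans ?_
  rw [natDegree_C, max_eq_right (Nat.zero_le _)]
  refine natDegree_mul_le.trans ?_
  rw [natDegree_C, add_zero]
  exact natDegree_X_le

theorem eval_dilate (z : τ → ℂ) (f : MvPolynomial τ ℂ) (r : MvPolynomial τ ℂ) :
    (dilate z f).eval r = MvPolynomial.aeval
      (fun x => MvPolynomial.C (z x) + r * (MvPolynomial.X x - MvPolynomial.C (z x))) f := by
  have : ((Polynomial.aeval r).restrictScalars ℂ).comp (dilate z) = MvPolynomial.aeval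
      (fun x => MvPolynomial.C (z x) + r * (MvPolynomial.X x - MvPolynomial.C (z x))) := by
    apply MvPolynomial.algHom_ext
    intro x
    simp [dilate]
  simpa [Polynomial.coe_aeval_eq_eval] using DFunLike.congr_fun this f

theorem eval_one_dilate (z : τ → ℂ) (f : MvPolynomial τ ℂ) : (dilate z f).eval 1 = f := by
  rw [eval_dilate]
  simp

/-- The constant coefficient of the dilation is the value at z. Divisibility of `dilate z f` by `X ^
k` thus serves as vanishing of f to order k at z. -/
theorem X_dvd_dilate {z : τ → ℂ} {f : MvPolynomial τ ℂ} (hf : MvPolynomial.eval z f = 0) :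
    X ∣ dilate z f := by
  rw [X_dvd_iff, coeff_zero_eq_eval_zero, eval_dilate]
  have : (MvPolynomial.aeval (fun x => MvPolynomial.C (z x) + 0 *
      (MvPolynomial.X x - MvPolynomial.C (z x))) : MvPolynomial τ ℂ →ₐ[ℂ] MvPolynomial τ ℂ) =
        (Algebra.ofId ℂ (MvPolynomial τ ℂ)).comp (MvPolynomial.aeval z) := by
    apply MvPolynomial.algHom_ext
    intro x
    simp [Algebra.ofId_apply, MvPolynomial.algebraMap_eq]
  rw [this, AlgHom.comp_apply, MvPolynomial.aeval_eq_eval, hf, map_zero]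

/-- One step of Newton's iteration with a truncated geometric series in place of the inverse of the
derivative: the order of vanishing of the error doubles. -/
theorem newton_step {R S : Type*} [CommRing R] [CommRing S] (φ : R →+* S) (X' : S)
    (q : R[X]) {p r d d' : R} (hd : d' * d = 1) (hp : q.eval p = 0)
    (hder : X' ∣ φ (q.derivative.eval p - d)) {k M : ℕ} (hk : 1 ≤ k) (hkM : k ≤ M)
    (hr : X' ^ k ∣ φ (r - p)) :
    X' ^ (2 * k) ∣ φ (r - q.eval r *
      ∑ j ∈ range M, d' * (1 - d' * q.derivative.eval r) ^ j - p) := by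
  obtain ⟨S₀, hS⟩ : ∃ S₀, q.eval p =
      q.eval r + q.derivative.eval r * (p - r) + S₀ * (p - r) ^ 2 := by
    obtain ⟨S₀, h⟩ := q.binomExpansion r (p - r)
    exact ⟨S₀, by simpa using h⟩
  set y := q.derivative.eval r with hy
  -- The truncated series inverts y up to (1 - d'y)^M. As d'y is 1 modulo X', this defect is
  -- divisible by X'^M, and no division is needed.
  have hgeom : (∑ j ∈ range M, d' * (1 - d' * y) ^ j) * y = 1 - (1 - d' * y) ^ M := by
    have h := mul_neg_geom_sum (1 - d' * y) M
    rw [← h, ← mul_sum]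
    ring
  have hone : X' ∣ φ (1 - d' * y) := by
    have h1 : X' ∣ φ (r - p) := (dvd_pow_self X' (by omega)).trans hr
    have h2 : X' ∣ φ (y - q.derivative.eval p) :=
      h1.trans (map_dvd φ (Polynomial.sub_dvd_eval_sub r p _))
    have h3 : 1 - d' * y = -d' * ((y - q.derivative.eval p) + (q.derivative.eval p - d)) := by
      linear_combination -hd
    rw [h3, map_mul, map_add]
    exact (dvd_add h2 hder).mul_left _
  have hM : X' ^ M ∣ φ ((1 - d' * y) ^ M) := by
    rw [map_pow]
    exact pow_dvd_pow_of_dvd hone M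
  have hqr : q.eval r = y * (r - p) - S₀ * (r - p) ^ 2 := by
    rw [hp] at hS
    linear_combination -hS
  -- The error splits into a part of order M + k, from truncating the series, and a part quadratic
  -- in r - p, of order 2k.
  have herr : r - q.eval r * ∑ j ∈ range M, d' * (1 - d' * y) ^ j - p =
      (1 - d' * y) ^ M * (r - p) +
        S₀ * (∑ j ∈ range M, d' * (1 - d' * y) ^ j) * ((r - p) * (r - p)) := by
    rw [hqr]
    linear_combination -(r - p) * hgeom
  rw [herr, map_add]
  refine dvd_add ?_ ?_
  · rw [map_mul]
    refine (pow_dvd_pow X' (show 2 * k ≤ M + k by omega)).trans ?_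
    rw [pow_add]
    exact mul_dvd_mul hM hr
  · rw [map_mul, map_mul φ (r - p), two_mul, pow_add]
    exact (mul_dvd_mul hr hr).mul_left _

/-- A polynomial of degree at most `m` is recovered from an approximation of order
`m + 1` by interpolation along the lines through `z`. -/
theorem HasCircuitOfSize.of_dilate_approx [Fintype τ] {z : τ → ℂ} {p r : MvPolynomial τ ℂ}
    {m E s : ℕ} (hp : p.totalDegree ≤ m) (hr : r.totalDegree ≤ E) (hs : HasCircuitOfSize r s)
    (h : X ^ (m + 1) ∣ dilate z (r - p)) :
    HasCircuitOfSize p ((E + 1) * (9 * Fintype.card τ + s + 2) + 1) := by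
  choose w hw using fun i => exists_coeff_eq_sum_eval E i
  let g : ℕ → τ → MvPolynomial τ ℂ := fun l x => MvPolynomial.C (z x) +
    MvPolynomial.C (l : ℂ) * (MvPolynomial.X x - MvPolynomial.C (z x))
  -- Setting the dilation factor to 1 makes p the sum of the coefficients of its dilation. Up to
  -- index m they agree with those of r, and the rest of r is discarded by adding only the weights
  -- for i ≤ m.
  have hpsum : p = ∑ l ∈ range (E + 1),
      MvPolynomial.C (∑ i ∈ range (m + 1), w i l) * MvPolynomial.aeval (g l) r := by
    have h1 : p = ∑ i ∈ range (m + 1), (dilate z p).coeff i := by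
      conv_lhs => rw [← eval_one_dilate z p]
      rw [eval_eq_sum_range' (Nat.lt_succ_of_le (natDegree_dilate_le hp))]
      simp
    have h2 : ∀ i ∈ range (m + 1), (dilate z p).coeff i = (dilate z r).coeff i := by
      intro i hi
      have := X_pow_dvd_iff.mp h i (mem_range.mp hi)
      rw [map_sub, coeff_sub, sub_eq_zero] at this
      exact this.symm
    rw [h1, sum_congr rfl h2,
      sum_congr rfl fun i _ => hw i (dilate z r) (natDegree_dilate_le hr), sum_comm]
    refine sum_congr rfl fun l _ => ?_
    rw [map_sum, sum_mul]
    refine sum_congr rfl fun i _ => ?_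
    rw [eval_dilate]
    simp [g, MvPolynomial.algebraMap_eq]
  rw [hpsum]
  have := HasCircuitOfSize.sum_const (S := range (E + 1)) (f := fun l =>
    MvPolynomial.C (∑ i ∈ range (m + 1), w i l) * MvPolynomial.aeval (g l) r)
      (s := 9 * Fintype.card τ + s + 2) fun l _ => ?_
  · simpa using this
  · refine HasCircuitOfSize.C_mul ?_ _
    have h := hs.aeval (g := g l) (t := fun _ => 9) fun x =>
      ((hasCircuitOfSize_C _).add (((hasCircuitOfSize_X _).sub (hasCircuitOfSize_C _)).C_mul _)).mono
        (by norm_num)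
    refine h.mono ?_
    simp [mul_comm]

/-- A polynomial root of a polynomial with a small circuit has a small circuit. -/
theorem hasCircuitOfSize_root [Fintype τ] {Q : MvPolynomial (Option τ) ℂ} {p : MvPolynomial τ ℂ}
    {D s m L : ℕ} (hQ : Q ≠ 0) (hroot : substNone p Q = 0) (hD : Q.totalDegree ≤ D)
    (hs : HasCircuitOfSize Q s) (hp : p.totalDegree ≤ m) (hL : m + 1 ≤ 2 ^ L) {s' F : ℕ}
    (hs' : s' = (D + 1) * (3 * (Fintype.card τ + 1) + s + 2) + 1)
    (hF : F = 2 ^ L * (2 ^ L * (s' + 6) + 3) + s' + 6) :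
    HasCircuitOfSize p (((D * (2 ^ L + 1) + 1) ^ L + 1) *
      (9 * Fintype.card τ + (L * (F + Fintype.card τ) + 1) + 2) + 1) := by
  classical
  set q := MvPolynomial.optionEquivLeft ℂ τ Q with hq
  have hq0 : q ≠ 0 := by simpa [hq] using hQ
  have hex : ∃ j, (hasseDeriv j q).eval p ≠ 0 := by
    by_contra! hcon
    exact hq0 (eq_zero_of_hasseDeriv_eq_zero q p hcon)
  -- With i + 1 the first order at which a Hasse derivative is nonzero at p, p is a simple root of
  -- the i-th one, whatever its multiplicity as a root of q.
  obtain ⟨i, hi0, hi1⟩ : ∃ i, (hasseDeriv i q).eval p = 0 ∧ (hasseDeriv (i + 1) q).eval p ≠ 0 := by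
    have hpos : Nat.find hex ≠ 0 := by
      intro h0
      have := Nat.find_spec hex
      rw [h0, hasseDeriv_zero, LinearMap.id_apply, hq, eval_optionEquivLeft] at this
      exact this hroot
    obtain ⟨i, hi⟩ := Nat.exists_eq_succ_of_ne_zero hpos
    refine ⟨i, ?_, ?_⟩
    · by_contra hne
      have := Nat.find_min' hex hne
      omega
    · have := Nat.find_spec hex
      rwa [hi] at this
  obtain ⟨Q₁, hQ₁D, hQ₁s, hQ₁⟩ := exists_hasseDeriv_circuit hD hs i
  obtain ⟨Q₂, hQ₂D, hQ₂s, hQ₂⟩ := exists_hasseDeriv_circuit hD hs (i + 1)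
  rw [← hs'] at hQ₁s hQ₂s
  set q₁ := hasseDeriv i q with hq₁
  have hder : ∀ r, q₁.derivative.eval r = ((i : MvPolynomial τ ℂ) + 1) * substNone r Q₂ := by
    intro r
    have h := LinearMap.congr_fun (hasseDeriv_comp (R := MvPolynomial τ ℂ) 1 i) q
    rw [LinearMap.comp_apply, hasseDeriv_one, Nat.choose_one_right, LinearMap.smul_apply,
      add_comm 1 i, ← hq₁] at h
    rw [h, hQ₂, eval_smul, nsmul_eq_mul]
    push_cast
    ring
  have hder0 : q₁.derivative.eval p ≠ 0 := by
    rw [hder, hQ₂]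
    exact mul_ne_zero (by exact_mod_cast Nat.succ_ne_zero i) hi1
  obtain ⟨z, hz⟩ : ∃ z, MvPolynomial.eval z (q₁.derivative.eval p) ≠ 0 := by
    by_contra! hcon
    exact hder0 (MvPolynomial.funext fun z => by simpa using hcon z)
  set δ := MvPolynomial.eval z (q₁.derivative.eval p) with hδ
  -- One Newton step, with the series always cut at `2 ^ L` terms. The same G then serves all L
  -- iterations, and their sizes add up while only the degree grows exponentially in L.
  let G : MvPolynomial (Option τ) ℂ := MvPolynomial.X none - Q₁ * ∑ j ∈ range (2 ^ L),
    MvPolynomial.C δ⁻¹ * (MvPolynomial.C 1 - MvPolynomial.C (δ⁻¹ * (i + 1)) * Q₂) ^ j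
  have hGs : HasCircuitOfSize G F := by
    have h1 := (hasCircuitOfSize_C (σ := Option τ) (1 : ℂ)).sub (hQ₂s.C_mul (δ⁻¹ * (i + 1)))
    have h2 := HasCircuitOfSize.sum_const (S := range (2 ^ L)) (f := fun j => MvPolynomial.C δ⁻¹ *
      (MvPolynomial.C 1 - MvPolynomial.C (δ⁻¹ * (i + 1)) * Q₂) ^ j)
      (s := 2 ^ L * (s' + 6) + 3) fun j hj => by
        refine ((h1.pow j).C_mul _).mono ?_
        have : j * (1 + (s' + 2) + 3) ≤ 2 ^ L * (1 + (s' + 2) + 3) :=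
          Nat.mul_le_mul_right _ (mem_range.mp hj).le
        have e : 1 + (s' + 2) + 3 = s' + 6 := by ring
        rw [e] at this ⊢
        omega
    refine ((hasCircuitOfSize_X none).sub (hQ₁s.mul h2)).mono ?_
    rw [card_range, hF]
    omega
  have hGD : G.totalDegree ≤ D * (2 ^ L + 1) + 1 := by
    refine (MvPolynomial.totalDegree_sub _ _).trans (max_le ?_ ?_)
    · rw [MvPolynomial.totalDegree_X]; omega
    · refine (MvPolynomial.totalDegree_mul _ _).trans ?_
      have : (∑ j ∈ range (2 ^ L), MvPolynomial.C δ⁻¹ * (MvPolynomial.C 1 -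
          MvPolynomial.C (δ⁻¹ * (i + 1)) * Q₂) ^ j).totalDegree ≤ 2 ^ L * D := by
        refine MvPolynomial.totalDegree_finsetSum_le fun j hj => ?_
        refine (MvPolynomial.totalDegree_mul _ _).trans ?_
        rw [MvPolynomial.totalDegree_C, zero_add]
        refine (MvPolynomial.totalDegree_pow _ _).trans
          (Nat.mul_le_mul (mem_range.mp hj).le ?_)
        refine (MvPolynomial.totalDegree_sub _ _).trans (max_le ?_ ?_)
        · rw [MvPolynomial.totalDegree_C]; omega
        · refine (MvPolynomial.totalDegree_mul _ _).trans ?_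
          rwa [MvPolynomial.totalDegree_C, zero_add]
      have e : D * (2 ^ L + 1) = D + 2 ^ L * D := by ring
      omega
  have hGsub : ∀ r, substNone r G = r - q₁.eval r * ∑ j ∈ range (2 ^ L),
      MvPolynomial.C δ⁻¹ * (1 - MvPolynomial.C δ⁻¹ * q₁.derivative.eval r) ^ j := by
    intro r
    have hC : ∀ a : ℂ, substNone r (MvPolynomial.C a) = MvPolynomial.C a := fun a => by
      simp [substNone, MvPolynomial.algebraMap_eq]
    have hX : substNone r (MvPolynomial.X none) = r := by simp [substNone]
    simp only [G, map_sub, map_mul, map_sum, map_pow, hC, hX, hder, hQ₁, map_add, map_natCast,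
      map_one]
    simp only [mul_assoc]
  -- The start is the constant p(z), which agrees with p to first order at z; after L doublings the
  -- order `2 ^ L` exceeds the degree of p.
  let r : ℕ → MvPolynomial τ ℂ := fun t =>
    (fun f => substNone f G)^[t] (MvPolynomial.C (MvPolynomial.eval z p))
  have hrs : ∀ t, r (t + 1) = substNone (r t) G := fun t => Function.iterate_succ_apply' _ _ _
  have hrsize : ∀ t, HasCircuitOfSize (r t) (t * (F + Fintype.card τ) + 1) := by
    intro t
    induction t with
    | zero => exact (hasCircuitOfSize_C _).mono (by omega)
    | succ t ih =>
      rw [hrs]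
      refine (hGs.substNone ih).mono ?_
      rw [Nat.succ_mul]
      omega
  have hrdeg : ∀ t, (r t).totalDegree ≤ (D * (2 ^ L + 1) + 1) ^ t := by
    intro t
    induction t with
    | zero => simp [r]
    | succ t ih =>
      rw [hrs, pow_succ']
      exact totalDegree_substNone_le hGD ih (Nat.one_le_pow _ _ (by omega))
  have happrox : ∀ t, t ≤ L → X ^ (2 ^ t) ∣ dilate z (r t - p) := by
    intro t
    induction t with
    | zero =>
      intro _
      rw [pow_zero, pow_one]
      exact X_dvd_dilate (by simp [r])
    | succ t ih =>
      intro ht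
      rw [hrs, hGsub, pow_succ']
      refine newton_step (dilate z).toRingHom X q₁ (d := MvPolynomial.C δ) ?_ hi0 ?_
        Nat.one_le_two_pow (Nat.pow_le_pow_right two_pos (by omega)) (ih (by omega))
      · rw [← MvPolynomial.C_mul, inv_mul_cancel₀ hz, MvPolynomial.C_1]
      · exact X_dvd_dilate (by simp [hδ])
  exact HasCircuitOfSize.of_dilate_approx hp (hrdeg L) (hrsize L)
    ((pow_dvd_pow X hL).trans (happrox L le_rfl))

end Root

/-! ### The hybrid argument: an annihilator of the permanent. -/

section Hybrid

open Finset

theorem totalDegree_permanent_le {κ : Type*} {m : ℕ} {M : Matrix (Fin m) (Fin m) (MvPolynomial κ ℂ)}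
    (hM : ∀ i j, (M i j).totalDegree ≤ 1) : M.permanent.totalDegree ≤ m := by
  refine MvPolynomial.totalDegree_finsetSum_le fun σ _ => ?_
  refine (MvPolynomial.totalDegree_finsetProd _ _).trans ?_
  exact (sum_le_sum fun i _ => hM (σ i) i).trans (by simp)

/-- The permanent of a matrix with few variable entries has a small circuit. -/
theorem hasCircuitOfSize_permanent_of_few_variables {κ : Type*} {m r : ℕ}
    (A : Finset (Fin m × Fin m)) (hA : #A ≤ r) (x : Fin m × Fin m → κ) (a : Fin m → Fin m → ℂ)
    (M : Matrix (Fin m) (Fin m) (MvPolynomial κ ℂ))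
    (hM : ∀ i j, M i j = if (i, j) ∈ A then MvPolynomial.X (x (i, j)) else MvPolynomial.C (a i j)) :
    HasCircuitOfSize M.permanent (2 ^ r * (r + 3) + 1) := by
  classical
  let U : Equiv.Perm (Fin m) → Finset (Fin m × Fin m) := fun σ => A.filter fun p => p.1 = σ p.2
  let c : Equiv.Perm (Fin m) → ℂ := fun σ => ∏ i with (σ i, i) ∉ A, a (σ i) i
  have hterm : ∀ σ : Equiv.Perm (Fin m), ∏ i, M (σ i) i =
      MvPolynomial.C (c σ) * ∏ p ∈ U σ, MvPolynomial.X (x p) := by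
    intro σ
    simp only [hM]
    rw [prod_ite, mul_comm, map_prod]
    congr 1
    refine prod_bij' (fun i _ => (σ i, i)) (fun p _ => p.2) ?_ ?_ ?_ ?_ ?_
    · intro i hi
      simpa [U] using hi
    · intro p hp
      simp only [U, mem_filter] at hp
      simp only [mem_filter, mem_univ, true_and, ← hp.2]
      exact hp.1
    · intro i _
      rfl
    · intro p hp
      simp only [U, mem_filter] at hp
      exact Prod.ext hp.2.symm rfl
    · intro i _
      rfl
  -- Permutations are grouped by the variable entries they pick. At most `2 ^ r` monomials remain,
  -- and their coefficients are single constant leaves however many permutations contribute.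
  have hperm : M.permanent = ∑ S ∈ A.powerset,
      MvPolynomial.C (∑ σ with U σ = S, c σ) * ∏ p ∈ S, MvPolynomial.X (x p) := by
    rw [Matrix.permanent, sum_congr rfl fun σ _ => hterm σ]
    rw [← sum_fiberwise_of_maps_to (s := univ) (t := A.powerset) (g := U)
      fun σ _ => mem_powerset.mpr (filter_subset _ _)]
    refine sum_congr rfl fun S _ => ?_
    rw [map_sum, sum_mul]
    refine sum_congr rfl fun σ hσ => ?_
    rw [(mem_filter.mp hσ).2]
  rw [hperm]
  refine (HasCircuitOfSize.sum_const (s := r + 3) fun S hS => ?_).mono ?_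
  · refine ((HasCircuitOfSize.prod_const (s := 1) fun p _ => hasCircuitOfSize_X _).C_mul _).mono ?_
    have := (card_le_card (mem_powerset.mp hS)).trans hA
    omega
  · rw [card_powerset]
    gcongr
    exact one_le_two

/-- If a polynomial `P` vanishes on all vectors of permanents of matrices that are read off a common
table along an almost disjoint family of index functions, then the permanent is a root of a
polynomial that is not much more complex than `P`. -/
theorem exists_annihilator_of_permanent {ι V : Type*} [Fintype ι] [DecidableEq ι] [DecidableEq V]
    {m r D s : ℕ} (h : ι → Fin m × Fin m → V)
    (hdesign : ∀ e e', e ≠ e' → #{p | h e p = h e' p} ≤ r)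
    {P : MvPolynomial ι ℂ} (hP : P ≠ 0) (hD : P.totalDegree ≤ D) (hs : HasCircuitOfSize P s)
    (hvan : ∀ α : Fin m → Fin m → V → ℂ,
      MvPolynomial.eval (fun e => Matrix.permanent fun i j => α i j (h e (i, j))) P = 0) :
    ∃ Q : MvPolynomial (Option (Fin m × Fin m)) ℂ, Q ≠ 0 ∧ substNone (permPoly ℂ m) Q = 0 ∧
      Q.totalDegree ≤ D * (m + 1) ∧
      HasCircuitOfSize Q (Fintype.card ι * (2 ^ r * (r + 3) + 1) + s) := by
  let hyb (T : Finset ι) (β : ι → ℂ) (α : Fin m → Fin m → V → ℂ) : ι → ℂ := fun e =>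
    if e ∈ T then Matrix.permanent fun i j => α i j (h e (i, j)) else β e
  -- With no coordinate replaced, P is nonzero at some β; with all replaced it vanishes for every
  -- table. Some single replacement must therefore make it vanish identically.
  obtain ⟨T, e, he, ⟨β, α, hT⟩, hT'⟩ : ∃ T, ∃ e ∉ T,
      (∃ β α, MvPolynomial.eval (hyb T β α) P ≠ 0) ∧
        ∀ β α, MvPolynomial.eval (hyb (insert e T) β α) P = 0 := by
    by_contra! hcon
    have hall : ∀ T : Finset ι, ∃ β α, MvPolynomial.eval (hyb T β α) P ≠ 0 := by
      intro T
      induction T using Finset.induction_on with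
      | empty =>
        by_contra! hz
        exact hP (MvPolynomial.funext fun β => by simpa [hyb] using hz β 0)
      | insert e T he ih =>
        exact hcon T e he ih
    obtain ⟨β, α, hne⟩ := hall univ
    exact hne (by simpa [hyb] using hvan α)
  -- Only the table places read by e become variables. Row e' of the design meets them exactly at
  -- the positions where it agrees with e, at most r of them when e' ≠ e.
  let M (e' : ι) : Matrix (Fin m) (Fin m) (MvPolynomial (Option (Fin m × Fin m)) ℂ) := fun i j =>
    if (i, j) ∈ ({p | h e' p = h e p} : Finset (Fin m × Fin m)) then MvPolynomial.X (some (i, j))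
      else MvPolynomial.C (α i j (h e' (i, j)))
  let g : ι → MvPolynomial (Option (Fin m × Fin m)) ℂ := fun e' =>
    if e' ∈ T then (M e').permanent else if e' = e then MvPolynomial.X none
      else MvPolynomial.C (β e')
  have hMM : ∀ (φ : MvPolynomial (Option (Fin m × Fin m)) ℂ →+* ℂ) (e' : ι),
      φ (M e').permanent = Matrix.permanent fun i j => φ (M e' i j) := by
    intro φ e'
    simp [Matrix.permanent, map_sum, map_prod]
  refine ⟨MvPolynomial.aeval g P, ?_, ?_, ?_, ?_⟩
  · intro h0
    apply hT
    -- Giving the new variables their old values recovers the point where P did not vanish.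
    let y : Option (Fin m × Fin m) → ℂ := fun o => o.elim (β e) fun p => α p.1 p.2 (h e p)
    have h1 : MvPolynomial.eval y (MvPolynomial.aeval g P) = 0 := by rw [h0, map_zero]
    rw [MvPolynomial.aeval_def, MvPolynomial.eval_eval₂] at h1
    rw [← h1, MvPolynomial.eval, MvPolynomial.coe_eval₂Hom]
    congr 1
    · ext a; simp [MvPolynomial.algebraMap_eq]
    · funext e'
      simp only [hyb, g]
      split_ifs with h1 h2
      · rw [hMM]
        congr 1
        funext i j
        simp only [M, mem_filter, mem_univ, true_and]
        split_ifs with h3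
        · simp [y, h3]
        · simp
      · subst h2; simp [y]
      · simp
  · refine MvPolynomial.funext fun y => ?_
    rw [map_zero]
    -- Writing y into the places read by e makes coordinate e the permanent of y, so the identity
    -- for `insert e T` applies.
    let α' : Fin m → Fin m → V → ℂ := fun i j v => if v = h e (i, j) then y (i, j) else α i j v
    rw [← hT' β α']
    let φ : MvPolynomial (Option (Fin m × Fin m)) ℂ →+* ℂ :=
      (MvPolynomial.eval y).comp (substNone (permPoly ℂ m)).toRingHom
    have hperm : MvPolynomial.eval y (permPoly ℂ m) = Matrix.permanent fun i j => y (i, j) := by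
      simp [permPoly, Matrix.permanent, map_sum, map_prod]
    change φ (MvPolynomial.aeval g P) = _
    rw [MvPolynomial.aeval_def, MvPolynomial.hom_eval₂, MvPolynomial.eval, MvPolynomial.coe_eval₂Hom]
    congr 1
    · ext a; simp [φ]
    · funext e'
      simp only [hyb, g, mem_insert]
      by_cases h1 : e' ∈ T
      · simp only [h1, or_true, if_true]
        rw [hMM]
        congr 1
        funext i j
        simp only [M, mem_filter, mem_univ, true_and, α']
        split_ifs with h3
        · simp [φ, substNone]
        · simp [φ, substNone]
      · by_cases h2 : e' = e
        · subst h2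
          simp [h1, φ, substNone, hperm, α']
        · simp [h1, h2, φ, substNone]
  · refine totalDegree_aeval_le hD fun e' => ?_
    simp only [g]
    split_ifs with h1 h2
    · refine (totalDegree_permanent_le fun i j => ?_).trans (Nat.le_succ m)
      simp only [M]
      split_ifs
      · simp
      · simp
    · simp
    · simp
  · have := hs.aeval (g := g) (t := fun _ => 2 ^ r * (r + 3) + 1) fun e' => ?_
    · simpa using this
    · simp only [g]
      split_ifs with h1 h2
      · exact hasCircuitOfSize_permanent_of_few_variables _
          (hdesign e' e fun heq => he (heq ▸ h1)) some (fun i j => α i j (h e' (i, j))) _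
          fun i j => rfl
      · exact (hasCircuitOfSize_X _).mono (by omega)
      · exact (hasCircuitOfSize_C _).mono (by omega)

end Hybrid

/-! ### The almost disjoint design from low-degree polynomials. -/

section Design

open Finset Polynomial

/-- Distinct exponent vectors with entries less than the prime `q` agree, as coefficient vectors of
polynomials over `ZMod q`, at few points. -/
theorem card_agree_le {κ : Type*} [Fintype κ] {n q : ℕ} [Fact q.Prime]
    (c : κ → ZMod q) (hc : Function.Injective c) {e e' : Fin n → ℕ}
    (he : ∀ l, e l < q) (he' : ∀ l, e' l < q) (hne : e ≠ e') :
    #{x : κ | ∑ l, (e l : ZMod q) * c x ^ (l : ℕ) = ∑ l, (e' l : ZMod q) * c x ^ (l : ℕ)} ≤ n := by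
  classical
  let p : (ZMod q)[X] := ∑ l : Fin n, C ((e l : ZMod q) - (e' l : ZMod q)) * X ^ (l : ℕ)
  have hcoeff : ∀ k : Fin n, p.coeff k = (e k : ZMod q) - (e' k : ZMod q) := by
    intro k
    simp only [p, finsetSum_coeff, coeff_C_mul, coeff_X_pow, Fin.val_inj]
    simp
  have hp : p ≠ 0 := by
    intro h0
    apply hne
    funext k
    have := hcoeff k
    rw [h0, coeff_zero, eq_comm, sub_eq_zero, ZMod.natCast_eq_natCast_iff'] at this
    rwa [Nat.mod_eq_of_lt (he k), Nat.mod_eq_of_lt (he' k)] at this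
  have hdeg : p.natDegree ≤ n := by
    refine natDegree_sum_le_of_forall_le _ _ fun l _ => ?_
    exact (natDegree_C_mul_X_pow_le _ _).trans l.isLt.le
  have hsub : (univ.filter fun x : κ => ∑ l, (e l : ZMod q) * c x ^ (l : ℕ) =
      ∑ l, (e' l : ZMod q) * c x ^ (l : ℕ)).image c ⊆ p.roots.toFinset := by
    intro y hy
    obtain ⟨x, hx, rfl⟩ := mem_image.mp hy
    rw [Multiset.mem_toFinset, mem_roots hp, IsRoot.def]
    simp only [mem_filter, mem_univ, true_and] at hx
    simp only [p, eval_finsetSum, eval_mul, eval_C, eval_pow, eval_X, sub_mul, sum_sub_distrib]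
    rw [hx, sub_self]
  rw [← card_image_of_injective _ hc]
  exact (card_le_card hsub).trans ((Multiset.toFinset_card_le _).trans
    ((card_roots' p).trans hdeg))

end Design

/-! ### Ryser's formula, Boolean tests and additive characters. -/

section ExponentialSums

open Finset

variable {R : Type*} [CommRing R]

/-- A Boolean as an element of a ring. -/
def bit (R : Type*) [CommRing R] (b : Bool) : R := if b then 1 else 0

@[simp] theorem bit_true : bit R true = 1 := rfl

@[simp] theorem bit_false : bit R false = 0 := rfl

/-- The summand in Ryser's formula for the permanent. -/
def ryserTerm {m : ℕ} (w : Fin m → R) (A : Fin m → Fin m → R) : R :=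
  (∏ j, (2 * w j - 1)) * ∏ i, ∑ j, w j * A i j

/-- Ryser's formula. -/
theorem permanent_eq_sum_ryserTerm {m : ℕ} (A : Fin m → Fin m → R) :
    (Matrix.of A).permanent = ∑ w : Fin m → Bool, ryserTerm (fun j => bit R (w j)) A := by
  classical
  simp only [ryserTerm]
  have hinner : ∀ f : Fin m → Fin m, ∑ w : Fin m → Bool,
      (∏ j, (2 * bit R (w j) - 1)) * ∏ i, bit R (w (f i)) =
        if Function.Surjective f then 1 else 0 := by
    intro f
    -- Bits are idempotent, so only the range of f matters, and the sum over w factors over the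
    -- columns.
    have h1 : ∀ w : Fin m → Bool, ∏ i, bit R (w (f i)) =
        ∏ j, if j ∈ Set.range f then bit R (w j) else 1 := by
      intro w
      by_cases hw : ∀ i, w (f i) = true
      · rw [prod_eq_one fun i _ => by simp [hw i], prod_eq_one]
        intro j _
        split_ifs with hj
        · obtain ⟨i, rfl⟩ := hj
          simp [hw i]
        · rfl
      · push Not at hw
        obtain ⟨i, hi⟩ := hw
        rw [ne_eq, Bool.not_eq_true] at hi
        rw [prod_eq_zero (mem_univ i) (by simp [hi]), prod_eq_zero (mem_univ (f i)) (by simp [hi])]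
    simp only [h1, ← prod_mul_distrib]
    rw [← Fintype.piFinset_univ, ← prod_univ_sum (fun _ => (univ : Finset Bool))
      (fun j b => (2 * bit R b - 1) * if j ∈ Set.range f then bit R b else 1)]
    -- Inclusion–exclusion in one column: the two signs cancel unless f hits j.
    have h2 : ∀ j : Fin m, ∑ b : Bool, (2 * bit R b - 1) *
        (if j ∈ Set.range f then bit R b else 1) = if j ∈ Set.range f then 1 else 0 := by
      intro j
      rw [Fintype.sum_bool]
      split_ifs
      · simp; norm_num
      · simp; norm_num
    simp only [h2]
    split_ifs with hf
    · exact prod_eq_one fun j _ => if_pos (hf j)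
    · obtain ⟨j, hj⟩ := not_forall.mp hf
      exact prod_eq_zero (mem_univ j) (if_neg hj)
  have hexp : ∀ w : Fin m → Bool, ∏ i, ∑ j, bit R (w j) * A i j =
      ∑ f : Fin m → Fin m, (∏ i, bit R (w (f i))) * ∏ i, A i (f i) := by
    intro w
    rw [prod_univ_sum, Fintype.piFinset_univ]
    exact sum_congr rfl fun f _ => prod_mul_distrib
  simp only [hexp, mul_sum]
  rw [sum_comm]
  have hsum : ∀ f : Fin m → Fin m, ∑ w : Fin m → Bool, (∏ j, (2 * bit R (w j) - 1)) *
      ((∏ i, bit R (w (f i))) * ∏ i, A i (f i)) =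
        (if Function.Surjective f then 1 else 0) * ∏ i, A i (f i) := by
    intro f
    rw [← hinner f, sum_mul]
    exact sum_congr rfl fun w _ => (mul_assoc _ _ _).symm
  rw [sum_congr rfl fun f _ => hsum f, ← Matrix.permanent_transpose, Matrix.permanent]
  refine Fintype.sum_of_injective (fun σ : Equiv.Perm (Fin m) => (σ : Fin m → Fin m))
    DFunLike.coe_injective _ _ ?_ ?_
  · intro f hf
    rw [if_neg, zero_mul]
    intro hs
    exact hf ⟨Equiv.ofBijective f (Finite.surjective_iff_bijective.mp hs), rfl⟩
  · intro σ
    simp [σ.surjective, Matrix.transpose_apply]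

/-- The polynomial that tests whether exactly one of the given Booleans is true. -/
def exactlyOne {V : Type*} [Fintype V] [DecidableEq V] (u : V → R) : R :=
  ∑ v, u v * ∏ v' ∈ univ.erase v, (1 - u v')

theorem exactlyOne_single {V : Type*} [Fintype V] [DecidableEq V] (v : V) :
    exactlyOne (fun x => bit R (decide (x = v))) = 1 := by
  rw [exactlyOne, sum_eq_single v]
  · rw [prod_eq_one]
    · simp
    · intro v' hv'
      simp [ne_of_mem_erase hv']
  · intro b _ hb
    simp [hb]
  · simp

theorem eq_single_of_exactlyOne_ne_zero {V : Type*} [Fintype V] [DecidableEq V] {u : V → Bool}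
    (h : exactlyOne (fun x => bit R (u x)) ≠ 0) : ∃ v, ∀ x, u x = decide (x = v) := by
  obtain ⟨v, -, hv⟩ := exists_ne_zero_of_sum_ne_zero h
  refine ⟨v, fun x => ?_⟩
  by_cases hx : x = v
  · subst hx
    by_contra hne
    have : u x = false := by simpa using hne
    exact hv (by simp [this])
  · by_contra hne
    have hux : u x = true := by simpa [hx] using hne
    refine hv ?_
    rw [prod_eq_zero (mem_erase.mpr ⟨hx, mem_univ x⟩), mul_zero]
    simp [hux]

/-- An exponential sum over all Boolean tables becomes a sum over functions when the summand is
multiplied with the test that every row has exactly one entry that is true. -/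
theorem sum_exactlyOne_mul {I V : Type*} [Fintype I] [DecidableEq I] [Fintype V] [DecidableEq V]
    (H : (I × V → Bool) → R) :
    ∑ u : I × V → Bool, (∏ l, exactlyOne fun x => bit R (u (l, x))) * H u =
      ∑ v : I → V, H fun p => decide (p.2 = v p.1) := by
  symm
  refine Fintype.sum_of_injective (fun (v : I → V) (p : I × V) => decide (p.2 = v p.1))
    ?_ _ _ ?_ ?_
  · intro v v' h
    funext l
    have := congrFun h (l, v l)
    simpa using this
  · intro u hu
    by_contra hne
    refine hu ?_
    have hl : ∀ l, ∃ v, ∀ x, u (l, x) = decide (x = v) := by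
      intro l
      refine eq_single_of_exactlyOne_ne_zero (R := R) fun h0 => hne ?_
      rw [prod_eq_zero (mem_univ l) h0, zero_mul]
    choose v hv using hl
    exact ⟨v, funext fun p => (hv p.1 p.2).symm⟩
  · intro v
    simp only
    rw [prod_eq_one fun l _ => exactlyOne_single (v l), one_mul]

theorem sum_single_mul {V : Type*} [Fintype V] [DecidableEq V] (v : V) (f : V → R) :
    ∑ x, bit R (decide (x = v)) * f x = f v := by
  rw [sum_eq_single v]
  · simp
  · intro b _ hb
    simp [hb]
  · simp

/-- The polynomial that tests whether one of the numbers `0, …, E` is at most `d`. -/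
noncomputable def leTest {σ : Type*} (d E : ℕ) (x : MvPolynomial σ ℂ) : MvPolynomial σ ℂ :=
  ∑ k ∈ range (d + 1), ∏ k' ∈ (range (E + 1)).erase k,
    MvPolynomial.C ((k : ℂ) - k')⁻¹ * (x - MvPolynomial.C (k' : ℂ))

/-- Each summand with k ≤ E is a Lagrange basis polynomial, the indicator of k on the nodes 0, …, E.
Summands with k > E have no factor erased and vanish at all nodes. -/
theorem leTest_natCast {σ : Type*} {d E κ : ℕ} (hκ : κ ≤ E) :
    leTest d E (MvPolynomial.C (κ : ℂ) : MvPolynomial σ ℂ) = if κ ≤ d then 1 else 0 := by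
  have h : ∀ k, (∏ k' ∈ (range (E + 1)).erase k, MvPolynomial.C ((k : ℂ) - k')⁻¹ *
      (MvPolynomial.C (κ : ℂ) - MvPolynomial.C (k' : ℂ)) : MvPolynomial σ ℂ) =
        if κ = k then 1 else 0 := by
    intro k
    split_ifs with hk
    · subst hk
      refine prod_eq_one fun k' hk' => ?_
      rw [← MvPolynomial.C_sub, ← MvPolynomial.C_mul, inv_mul_cancel₀, MvPolynomial.C_1]
      rw [sub_ne_zero]
      exact_mod_cast (ne_of_mem_erase hk').symm
    · refine prod_eq_zero (mem_erase.mpr ⟨hk, mem_range.mpr (Nat.lt_succ_of_le hκ)⟩) ?_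
      rw [sub_self, mul_zero]
  simp only [leTest, h, sum_ite_eq, mem_range, Nat.lt_succ_iff]

/-- Every function on `ZMod q` is a combination of additive characters. -/
theorem exists_character_expansion {q : ℕ} [NeZero q] (α : ZMod q → ℂ) :
    ∃ a : ZMod q → ℂ, ∀ x, α x = ∑ s, a s * ZMod.stdAddChar (s * x) := by
  refine ⟨fun s => (q : ℂ)⁻¹ * ZMod.dft α s, fun x => ?_⟩
  have h := congrFun (ZMod.dft.symm_apply_apply α) x
  rw [← h, ZMod.invDFT_apply, smul_eq_mul, mul_sum]
  refine sum_congr rfl fun s _ => ?_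
  rw [smul_eq_mul, mul_assoc, mul_comm (ZMod.dft α s)]

/-- A character at ∑ e_l c^l becomes a product of factors depending on one exponent each, hence of
linear forms in the indicator bits. -/
theorem addChar_sum {A M ι : Type*} [AddCommMonoid A] [CommMonoid M] (ψ : AddChar A M)
    (S : Finset ι) (f : ι → A) : ψ (∑ i ∈ S, f i) = ∏ i ∈ S, ψ (f i) := by
  classical
  induction S using Finset.induction_on with
  | empty => simp
  | insert a S ha ih => rw [sum_insert ha, prod_insert ha, AddChar.map_add_eq_mul, ih]

end ExponentialSums

/-! ### Splitting the auxiliary bits into two groups. -/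

section BoolSum

open Finset

/-- Later I indexes the indicator table of an exponent vector and J the bits of Ryser's formula. -/
theorem boolSum_eq {K I J : Type*} [CommRing K] [Fintype I] [Fintype J] [DecidableEq I]
    [DecidableEq J] {n k : ℕ}
    (e : I ⊕ J ≃ Fin k) (g : MvPolynomial (Fin n ⊕ Fin k) K) :
    boolSum g = ∑ u : I → Bool, ∑ w : J → Bool, MvPolynomial.aeval (Sum.elim MvPolynomial.X
      (fun j => bit (MvPolynomial (Fin n) K) (Sum.elim u w (e.symm j)))) g := by
  rw [← Fintype.sum_prod_type', boolSum]
  refine Fintype.sum_equiv ((Equiv.arrowCongr e.symm (Equiv.refl Bool)).trans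
    (Equiv.sumArrowEquivProdArrow I J Bool)) _ _ fun b => ?_
  congr 2
  funext j
  rcases j with j | j
  · rfl
  · simp only [Sum.elim_inr, bit]
    have : Sum.elim (((Equiv.arrowCongr e.symm (Equiv.refl Bool)).trans
      (Equiv.sumArrowEquivProdArrow I J Bool)) b).1 (((Equiv.arrowCongr e.symm
        (Equiv.refl Bool)).trans (Equiv.sumArrowEquivProdArrow I J Bool)) b).2 (e.symm j) = b j := by
      rcases h : e.symm j with i | i <;> simp [Equiv.sumArrowEquivProdArrow, ← h]
    rw [this]

end BoolSum

/-! ### Joint bookkeeping of degree and size. -/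

section Small

open Finset

variable {σ ι : Type*}

/-- Degree and circuit size are at most `B ^ k`. -/
structure Small (B k : ℕ) (f : MvPolynomial σ ℂ) : Prop where
  deg : f.totalDegree ≤ B ^ k
  size : HasCircuitOfSize f (B ^ k)

variable {B k : ℕ} {f g : MvPolynomial σ ℂ}

theorem Small.mono (hf : Small B k f) (hB : 4 ≤ B) {l : ℕ} (hkl : k ≤ l) : Small B l f :=
  ⟨hf.deg.trans (Nat.pow_le_pow_right (by omega) hkl),
    hf.size.mono (Nat.pow_le_pow_right (by omega) hkl)⟩

theorem small_X (x : σ) : Small B 0 (MvPolynomial.X x : MvPolynomial σ ℂ) :=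
  ⟨by simp, by simpa using hasCircuitOfSize_X x⟩

theorem small_C (a : ℂ) : Small B 0 (MvPolynomial.C a : MvPolynomial σ ℂ) :=
  ⟨by simp, by simpa using hasCircuitOfSize_C a⟩

theorem small_one : Small B 0 (1 : MvPolynomial σ ℂ) := small_C 1

/-- A factor `B ^ 2` absorbs either B-fold fan-in with one extra gate or the overhead of a binary
operation, so each operation costs two in the exponent. -/
theorem le_pow_add_two {B k s : ℕ} (hB : 4 ≤ B) (hs : s ≤ B * B ^ k + 1 ∨ s ≤ 5 * B ^ k) :
    s ≤ B ^ (k + 2) := by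
  have h1 : 1 ≤ B ^ k := Nat.one_le_pow _ _ (by omega)
  have h2 : B ^ (k + 2) = B * B * B ^ k := by ring
  rw [h2]
  have h3 : 4 * B ≤ B * B := Nat.mul_le_mul_right B hB
  rcases hs with hs | hs
  · nlinarith
  · nlinarith [Nat.mul_le_mul_right (B ^ k) h3, Nat.mul_le_mul_right (B ^ k) hB]

theorem Small.sum (hB : 4 ≤ B) {S : Finset ι} {f : ι → MvPolynomial σ ℂ} (hS : #S ≤ B)
    (h : ∀ i ∈ S, Small B k (f i)) : Small B (k + 2) (∑ i ∈ S, f i) := by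
  refine ⟨MvPolynomial.totalDegree_finsetSum_le fun i hi => (h i hi).deg.trans
    (Nat.pow_le_pow_right (by omega) (by omega)),
    (HasCircuitOfSize.sum_const fun i hi => (h i hi).size).mono (le_pow_add_two hB (Or.inl ?_))⟩
  gcongr

theorem Small.prod (hB : 4 ≤ B) {S : Finset ι} {f : ι → MvPolynomial σ ℂ} (hS : #S ≤ B)
    (h : ∀ i ∈ S, Small B k (f i)) : Small B (k + 2) (∏ i ∈ S, f i) := by
  refine ⟨(MvPolynomial.totalDegree_finsetProd _ _).trans
    ((sum_le_sum fun i hi => (h i hi).deg).trans (le_pow_add_two hB (Or.inl ?_))),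
    (HasCircuitOfSize.prod_const fun i hi => (h i hi).size).mono (le_pow_add_two hB (Or.inl ?_))⟩
  · rw [sum_const, smul_eq_mul]
    exact (Nat.mul_le_mul_right _ hS).trans (Nat.le_succ _)
  · gcongr

theorem Small.pow (hB : 4 ≤ B) {j : ℕ} (hj : j ≤ B) (hf : Small B k f) :
    Small B (k + 2) (f ^ j) := by
  have := Small.prod (S := range j) (f := fun _ => f) hB (by simpa using hj) fun _ _ => hf
  simpa using this

theorem Small.mul (hB : 4 ≤ B) (hf : Small B k f) (hg : Small B k g) : Small B (k + 2) (f * g) := by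
  have h1 : 1 ≤ B ^ k := Nat.one_le_pow _ _ (by omega)
  refine ⟨(MvPolynomial.totalDegree_mul _ _).trans (le_pow_add_two hB (Or.inr ?_)),
    (hf.size.mul hg.size).mono (le_pow_add_two hB (Or.inr ?_))⟩
  · have := hf.deg; have := hg.deg; omega
  · omega

theorem Small.sub (hB : 4 ≤ B) (hf : Small B k f) (hg : Small B k g) : Small B (k + 2) (f - g) := by
  have h1 : 1 ≤ B ^ k := Nat.one_le_pow _ _ (by omega)
  refine ⟨(MvPolynomial.totalDegree_sub _ _).trans (le_pow_add_two hB (Or.inr ?_)),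
    (hf.size.sub hg.size).mono (le_pow_add_two hB (Or.inr ?_))⟩
  · have := hf.deg; have := hg.deg; omega
  · omega

theorem small_exactlyOne (hB : 4 ≤ B) {V : Type*} [Fintype V] [DecidableEq V]
    (hV : Fintype.card V ≤ B) {u : V → MvPolynomial σ ℂ} (hu : ∀ v, Small B 0 (u v)) :
    Small B 8 (exactlyOne u) := by
  refine Small.sum hB (by simpa using hV) fun v _ => ?_
  refine Small.mul hB ((hu v).mono hB (Nat.zero_le 4)) ?_
  refine Small.prod hB (((card_le_univ _)).trans hV) fun v' _ => ?_
  exact small_one.sub hB (hu v')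

theorem Small.leTest (hB : 4 ≤ B) {d E : ℕ} (hd : d + 1 ≤ B) (hE : E + 1 ≤ B) (hf : Small B k f) :
    Small B (k + 8) (leTest d E f) := by
  refine Small.sum hB (by simpa using hd) fun i _ => ?_
  refine Small.prod hB ?_ fun j _ => ?_
  · exact (card_erase_le).trans (by simpa using hE)
  · exact Small.mul hB ((small_C _).mono hB (Nat.zero_le _))
      (hf.sub hB ((small_C _).mono hB (Nat.zero_le _)))

end Small

/-! ### The generator as an exponential sum. -/

section ExplicitFamily

open Finset

theorem map_exactlyOne {R S V : Type*} [CommRing R] [CommRing S] [Fintype V] [DecidableEq V]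
    (φ : R →+* S) (u : V → R) : φ (exactlyOne u) = exactlyOne fun v => φ (u v) := by
  simp [exactlyOne, map_sum, map_prod]

theorem map_leTest {σ τ : Type*} (φ : MvPolynomial σ ℂ →ₐ[ℂ] MvPolynomial τ ℂ) (d E : ℕ)
    (x : MvPolynomial σ ℂ) : φ (leTest d E x) = leTest d E (φ x) := by
  have hC : ∀ a, φ (MvPolynomial.C a) = MvPolynomial.C a := fun a => φ.commutes a
  simp only [leTest, map_sum, map_prod, map_mul, map_sub, hC]

variable {σ τ : Type*} {n m q : ℕ}

/-- If `U` is the indicator table of an exponent vector, then this is the monomial with that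
exponent vector if its degree is at most `d`, and zero otherwise. -/
noncomputable def monomialTerm (d : ℕ) (U : Fin n → Fin (n + 1) → MvPolynomial σ ℂ)
    (x : Fin n → MvPolynomial σ ℂ) : MvPolynomial σ ℂ :=
  leTest d (n * n) (∑ l, ∑ v, U l v * MvPolynomial.C ((v : ℕ) : ℂ)) *
    ∏ l, ∑ v, U l v * x l ^ (v : ℕ)

/-- If `U` is the indicator table of an exponent vector, then this is the combination with
coefficients `a` of the characters of `ZMod q` at the value at `c` of the polynomial with that
coefficient vector. -/
noncomputable def characterSum [NeZero q] (a : ZMod q → ℂ) (c : ZMod q)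
    (U : Fin n → Fin (n + 1) → MvPolynomial σ ℂ) : MvPolynomial σ ℂ :=
  ∑ s, MvPolynomial.C (a s) * ∏ l : Fin n, ∑ v : Fin (n + 1), U l v *
    MvPolynomial.C (ZMod.stdAddChar (s * (((v : ℕ) : ZMod q) * c ^ (l : ℕ))))

theorem map_monomialTerm (φ : MvPolynomial σ ℂ →ₐ[ℂ] MvPolynomial τ ℂ) (d : ℕ)
    (U : Fin n → Fin (n + 1) → MvPolynomial σ ℂ) (x : Fin n → MvPolynomial σ ℂ) :
    φ (monomialTerm d U x) = monomialTerm d (fun l v => φ (U l v)) fun l => φ (x l) := by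
  have hC : ∀ a, φ (MvPolynomial.C a) = MvPolynomial.C a := fun a => φ.commutes a
  simp only [monomialTerm, map_leTest, map_sum, map_prod, map_mul, map_pow, hC]

theorem map_characterSum [NeZero q] (φ : MvPolynomial σ ℂ →ₐ[ℂ] MvPolynomial τ ℂ)
    (a : ZMod q → ℂ) (c : ZMod q) (U : Fin n → Fin (n + 1) → MvPolynomial σ ℂ) :
    φ (characterSum a c U) = characterSum a c fun l v => φ (U l v) := by
  have hC : ∀ a, φ (MvPolynomial.C a) = MvPolynomial.C a := fun a => φ.commutes a
  simp only [characterSum, map_sum, map_prod, map_mul, hC]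

theorem map_ryserTerm {R S : Type*} [CommRing R] [CommRing S] (φ : R →+* S) (w : Fin m → R)
    (A : Fin m → Fin m → R) :
    φ (ryserTerm w A) = ryserTerm (fun j => φ (w j)) fun i j => φ (A i j) := by
  simp [ryserTerm, map_sum, map_prod, map_ofNat]

theorem monomialTerm_single (d : ℕ) (v : Fin n → Fin (n + 1)) :
    monomialTerm d (fun l x => bit (MvPolynomial (Fin n) ℂ) (decide (x = v l))) MvPolynomial.X =
      (if ∑ l, (v l : ℕ) ≤ d then 1 else 0) * ∏ l, MvPolynomial.X l ^ (v l : ℕ) := by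
  rw [monomialTerm]
  congr 1
  · simp only [sum_single_mul]
    rw [← leTest_natCast (σ := Fin n) (E := n * n)]
    · push_cast [map_sum]
      rfl
    · calc ∑ l, (v l : ℕ) ≤ ∑ l : Fin n, n := sum_le_sum fun l _ => Nat.lt_succ_iff.mp (v l).isLt
        _ = n * n := by simp
  · exact prod_congr rfl fun l _ => sum_single_mul (v l) _

theorem characterSum_single [NeZero q] (a : ZMod q → ℂ) (c : ZMod q) (v : Fin n → Fin (n + 1)) :
    characterSum a c (fun l x => bit (MvPolynomial σ ℂ) (decide (x = v l))) =
      MvPolynomial.C (∑ s, a s *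
        ZMod.stdAddChar (s * ∑ l, ((v l : ℕ) : ZMod q) * c ^ (l : ℕ))) := by
  simp only [characterSum, sum_single_mul]
  rw [map_sum]
  refine sum_congr rfl fun s _ => ?_
  rw [mul_sum, addChar_sum, map_mul, map_prod]

variable {B k : ℕ}

theorem small_monomialTerm (hB : 4 ≤ B) (hn : n * n + n + 1 ≤ B) {d : ℕ} (hd : d ≤ n)
    {U : Fin n → Fin (n + 1) → MvPolynomial σ ℂ} (hU : ∀ l v, Small B 0 (U l v))
    {x : Fin n → MvPolynomial σ ℂ} (hx : ∀ l, Small B 0 (x l)) :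
    Small B 16 (monomialTerm d U x) := by
  have hn1 : #(univ : Finset (Fin (n + 1))) ≤ B := by rw [card_univ, Fintype.card_fin]; nlinarith
  have hn0 : #(univ : Finset (Fin n)) ≤ B := by rw [card_univ, Fintype.card_fin]; nlinarith
  refine Small.mul hB (k := 14) (Small.leTest hB (by nlinarith) (by omega) (Small.sum hB hn0
    fun l _ => Small.sum hB hn1 fun v _ => (hU l v).mul hB (small_C _))) ?_
  refine Small.mono (k := 8) ?_ hB (by norm_num)
  refine Small.prod hB hn0 fun l _ => Small.sum hB hn1 fun v _ =>
    ((hU l v).mono hB (Nat.zero_le _)).mul hB ((hx l).pow hB ?_)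
  have := v.isLt
  nlinarith

theorem small_characterSum [NeZero q] (hB : 4 ≤ B) (hn : n + 1 ≤ B) (hq : q ≤ B) (a : ZMod q → ℂ)
    (c : ZMod q) {U : Fin n → Fin (n + 1) → MvPolynomial σ ℂ} (hU : ∀ l v, Small B 0 (U l v)) :
    Small B 10 (characterSum a c U) := by
  refine Small.sum hB (by rwa [card_univ, ZMod.card]) fun s _ =>
    ((small_C _).mono hB (Nat.zero_le _)).mul hB (Small.prod hB ?_ fun l _ =>
      Small.sum hB ?_ fun v _ => (hU l v).mul hB (small_C _))
  · rw [card_univ, Fintype.card_fin]; omega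
  · rwa [card_univ, Fintype.card_fin]

theorem small_ryserTerm (hB : 4 ≤ B) (hm : m ≤ B) {w : Fin m → MvPolynomial σ ℂ}
    (hw : ∀ j, Small B 0 (w j)) {A : Fin m → Fin m → MvPolynomial σ ℂ}
    (hA : ∀ i j, Small B k (A i j)) : Small B (k + 8) (ryserTerm w A) := by
  have hm0 : #(univ : Finset (Fin m)) ≤ B := by rwa [card_univ, Fintype.card_fin]
  have h2 : Small B 0 (2 : MvPolynomial σ ℂ) := by
    have := small_C (B := B) (σ := σ) 2
    rwa [map_ofNat] at this
  refine Small.mul hB (k := k + 6) (Small.mono (k := 6) ?_ hB (by omega)) ?_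
  · exact Small.prod hB hm0 fun j _ =>
      (h2.mul hB (hw j)).sub hB (small_one.mono hB (Nat.zero_le _))
  · exact Small.prod hB hm0 fun i _ => Small.sum hB hm0 fun j _ =>
      ((hw j).mono hB (Nat.zero_le _)).mul hB (hA i j)

/-- The polynomial of degree at most `d` whose coefficients are the permanents of matrices that are
read off the table `α` at places given by the exponent vectors is an exponential sum of a small
polynomial. -/
theorem exists_boolSum_eq_sum_permanent {d : ℕ} [NeZero q] (hB : 4 ≤ B) (hd : d ≤ n)
    (hn : n * n + n + 1 ≤ B) (hm : m ≤ B) (hq : q ≤ B)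
    (e : (Fin n × Fin (n + 1)) ⊕ Fin m ≃ Fin k)
    (c : Fin m → Fin m → ZMod q) (α : Fin m → Fin m → ZMod q → ℂ) :
    ∃ g : MvPolynomial (Fin n ⊕ Fin k) ℂ, Small B 22 g ∧
      boolSum g = ∑ v : Fin n → Fin (n + 1), ((if ∑ l, (v l : ℕ) ≤ d then 1 else 0) *
        ∏ l, MvPolynomial.X l ^ (v l : ℕ)) * Matrix.permanent (Matrix.of fun i j =>
          MvPolynomial.C (α i j (∑ l, ((v l : ℕ) : ZMod q) * c i j ^ (l : ℕ)))) := by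
  classical
  choose a ha using fun i j => exists_character_expansion (α i j)
  let U : Fin n → Fin (n + 1) → MvPolynomial (Fin n ⊕ Fin k) ℂ := fun l v =>
    MvPolynomial.X (Sum.inr (e (Sum.inl (l, v))))
  let W : Fin m → MvPolynomial (Fin n ⊕ Fin k) ℂ := fun j =>
    MvPolynomial.X (Sum.inr (e (Sum.inr j)))
  have hU : ∀ l v, Small B 0 (U l v) := fun l v => small_X _
  -- The first factor keeps only indicator tables of exponent vectors, the second is the monomial,
  -- and the third sums to the permanent over the bits `W`.
  refine ⟨(∏ l, exactlyOne (U l)) * (monomialTerm d U (fun l => MvPolynomial.X (Sum.inl l)) *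
    ryserTerm W fun i j => characterSum (a i j) (c i j) U), ?_, ?_⟩
  · refine Small.mul hB (k := 20) (Small.mono (k := 10) ?_ hB (by norm_num))
      (Small.mul hB (k := 18) ?_ ?_)
    · exact Small.prod hB (by rw [card_univ, Fintype.card_fin]; nlinarith) fun l _ =>
        small_exactlyOne hB (by rw [Fintype.card_fin]; nlinarith) (hU l)
    · exact (small_monomialTerm hB hn hd hU fun l => small_X _).mono hB (by norm_num)
    · exact small_ryserTerm hB hm (fun j => small_X _) fun i j =>
        small_characterSum hB (by nlinarith) hq _ _ hU
  · rw [boolSum_eq e]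
    let H : (Fin n × Fin (n + 1) → Bool) → MvPolynomial (Fin n) ℂ := fun u =>
      monomialTerm d (fun l v => bit _ (u (l, v))) MvPolynomial.X * Matrix.permanent (Matrix.of fun i j =>
        characterSum (a i j) (c i j) fun l v => bit (MvPolynomial (Fin n) ℂ) (u (l, v)))
    have hH : ∀ u : Fin n × Fin (n + 1) → Bool, ∑ w : Fin m → Bool,
        MvPolynomial.aeval (Sum.elim MvPolynomial.X
          (fun j => bit (MvPolynomial (Fin n) ℂ) (Sum.elim u w (e.symm j))))
          ((∏ l, exactlyOne (U l)) * (monomialTerm d U (fun l => MvPolynomial.X (Sum.inl l)) *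
            ryserTerm W fun i j => characterSum (a i j) (c i j) U)) =
        (∏ l, exactlyOne fun x => bit (MvPolynomial (Fin n) ℂ) (u (l, x))) * H u := by
      intro u
      simp only [H]
      rw [permanent_eq_sum_ryserTerm, mul_sum, mul_sum]
      refine sum_congr rfl fun w _ => ?_
      set φ := MvPolynomial.aeval (R := ℂ) (Sum.elim MvPolynomial.X
        (fun j => bit (MvPolynomial (Fin n) ℂ) (Sum.elim u w (e.symm j)))) with hφ
      have hφU : ∀ l v, φ (U l v) = bit _ (u (l, v)) := fun l v => by simp [hφ, U]
      have hφW : ∀ j, φ (W j) = bit _ (w j) := fun j => by simp [hφ, W]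
      have hφX : ∀ l, φ (MvPolynomial.X (Sum.inl l)) = MvPolynomial.X l := fun l => by simp [hφ]
      have hφO : ∀ l, φ (exactlyOne (U l)) = exactlyOne fun x => bit _ (u (l, x)) := fun l =>
        (map_exactlyOne φ.toRingHom (U l)).trans (congrArg exactlyOne (funext (hφU l)))
      have hφR : φ (ryserTerm W fun i j => characterSum (a i j) (c i j) U) =
          ryserTerm (fun j => φ (W j)) fun i j => φ (characterSum (a i j) (c i j) U) :=
        map_ryserTerm φ.toRingHom _ _
      rw [map_mul, map_mul, map_prod, hφR, map_monomialTerm]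
      simp only [map_characterSum, hφO, hφU, hφW, hφX]
    rw [sum_congr rfl fun u _ => hH u, sum_exactlyOne_mul H]
    refine sum_congr rfl fun v _ => ?_
    simp only [H, monomialTerm_single, characterSum_single, ha]

end ExplicitFamily

/-! ### The generator takes values in the slice of `VNP`. -/

section Slice

open Finset

theorem prod_X_pow_eq_monomial {n : ℕ} (v : Fin n → ℕ) :
    ∏ l, (MvPolynomial.X l : MvPolynomial (Fin n) ℂ) ^ v l =
      MvPolynomial.monomial (Finsupp.equivFunOnFinite.symm v) 1 := by
  rw [MvPolynomial.monomial_eq, MvPolynomial.C_1, one_mul, Finsupp.prod_fintype]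
  · simp
  · simp

theorem le_of_monIdx {n d : ℕ} (e : MonIdx n d) (l : Fin n) : e.1 l ≤ d :=
  (Finsupp.le_degree l e.1).trans e.2

/-- The vectors of permanents read off a table are coefficient vectors of polynomials in `VNP`. -/
theorem exists_mem_VNPSlice {n m q d B c₀ : ℕ} [NeZero q] (hB : 4 ≤ B) (hd : d ≤ n)
    (hn : n * n + n + 1 ≤ B) (hm : m ≤ B) (hq : q ≤ B) (hc₀ : B ^ 22 ≤ n ^ c₀)
    (c : Fin m → Fin m → ZMod q) (α : Fin m → Fin m → ZMod q → ℂ) :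
    ∃ f ∈ VNPSlice ℂ c₀ n d, ∀ e : MonIdx n d, coeffVec d f e =
      Matrix.permanent fun i j => α i j (∑ l, (e.1 l : ZMod q) * c i j ^ (l : ℕ)) := by
  classical
  let ψ : (Fin n × Fin (n + 1)) ⊕ Fin m ≃ Fin (n * (n + 1) + m) :=
    (Equiv.sumCongr finProdFinEquiv (Equiv.refl _)).trans finSumFinEquiv
  obtain ⟨g, hg, hsum⟩ := exists_boolSum_eq_sum_permanent hB hd hn hm hq ψ c α
  let t : (Fin n → Fin (n + 1)) → ℂ := fun v =>
    Matrix.permanent fun i j => α i j (∑ l, ((v l : ℕ) : ZMod q) * c i j ^ (l : ℕ))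
  have hf : boolSum g = ∑ v : Fin n → Fin (n + 1), if ∑ l, (v l : ℕ) ≤ d then
      MvPolynomial.monomial (Finsupp.equivFunOnFinite.symm fun l => (v l : ℕ)) (t v) else 0 := by
    rw [hsum]
    refine sum_congr rfl fun v _ => ?_
    have hC : (Matrix.of fun i j => (MvPolynomial.C
        (α i j (∑ l, ((v l : ℕ) : ZMod q) * c i j ^ (l : ℕ))) : MvPolynomial (Fin n) ℂ)).permanent =
        MvPolynomial.C (t v) := by
      simp [t, Matrix.permanent, map_sum, map_prod]
    rw [hC, prod_X_pow_eq_monomial]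
    split_ifs
    · rw [one_mul, mul_comm, MvPolynomial.C_mul_monomial, mul_one]
    · rw [zero_mul, zero_mul]
  refine ⟨boolSum g, ⟨?_, n * (n + 1) + m, g, ?_, hg.deg.trans hc₀, hg.size.mono hc₀, rfl⟩, ?_⟩
  · rw [hf]
    refine MvPolynomial.totalDegree_finsetSum_le fun v _ => ?_
    split_ifs with hv
    · refine (MvPolynomial.totalDegree_monomial_le _ _).trans ?_
      rw [Finsupp.sum_fintype _ _ fun _ => rfl]
      simpa using hv
    · simp
  · refine le_trans ?_ hc₀
    have h1 : n * (n + 1) + m ≤ B * B := by nlinarith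
    calc n * (n + 1) + m ≤ B ^ 2 := by rwa [sq]
      _ ≤ B ^ 22 := Nat.pow_le_pow_right (by omega) (by norm_num)
  · intro e
    let v : Fin n → Fin (n + 1) := fun l => ⟨e.1 l, by have := le_of_monIdx e l; omega⟩
    have hev : (Finsupp.equivFunOnFinite.symm fun l => ((v l : Fin (n + 1)) : ℕ)) = e.1 := by
      ext l; simp [v]
    have hdeg : ∑ l, (v l : ℕ) ≤ d := by
      have := e.2
      rwa [Finsupp.degree_eq_sum] at this
    rw [coeffVec, hf, MvPolynomial.coeff_sum, sum_eq_single v]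
    · rw [if_pos hdeg, hev, MvPolynomial.coeff_monomial, if_pos rfl]
    · intro v' _ hne
      split_ifs with h
      · rw [MvPolynomial.coeff_monomial, if_neg]
        rintro h'
        apply hne
        funext l
        apply Fin.ext
        have := DFunLike.congr_fun h' l
        simpa [v] using this
      · exact MvPolynomial.coeff_zero _
    · simp

instance (n d : ℕ) : Finite (MonIdx n d) :=
  Finite.of_injective (β := Fin n → Fin (d + 1))
    (fun e l => ⟨e.1 l, Nat.lt_succ_of_le (le_of_monIdx e l)⟩) fun e e' h => by
      apply Subtype.ext
      ext l
      exact congrArg Fin.val (congrFun h l)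

theorem card_monIdx_le (n d : ℕ) [Fintype (MonIdx n d)] :
    Fintype.card (MonIdx n d) ≤ (d + 1) ^ n := by
  have h := Fintype.card_le_of_injective (β := Fin n → Fin (d + 1))
    (fun (e : MonIdx n d) l => (⟨e.1 l, Nat.lt_succ_of_le (le_of_monIdx e l)⟩ : Fin (d + 1)))
    fun e e' h => by
      apply Subtype.ext
      ext l
      exact congrArg Fin.val (congrFun h l)
  simpa using h

end Slice

/-! ### Numerical bounds and the circuit for the permanent. -/

section Bounds

open Finset Filter

/-- The exponent 3L comes from L Newton steps, each multiplying the degree by at most B³; the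
remaining 11 is 8 for the iterated circuit and 3 for slack. -/
theorem root_size_bound {D v s L B : ℕ} (hB : 16 ≤ B) (hD : D + 1 ≤ B) (hv : v + 1 ≤ B)
    (hs : s ≤ B) (hL : 2 ^ L ≤ B) {s' F : ℕ}
    (hs' : s' = (D + 1) * (3 * (v + 1) + s + 2) + 1)
    (hF : F = 2 ^ L * (2 ^ L * (s' + 6) + 3) + s' + 6) :
    ((D * (2 ^ L + 1) + 1) ^ L + 1) * (9 * v + (L * (F + v) + 1) + 2) + 1 ≤ B ^ (3 * L + 11) := by
  have hLB : L ≤ B := (Nat.lt_two_pow_self).le.trans hL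
  have h1 : s' + 6 ≤ B ^ 3 := by
    have : (D + 1) * (3 * (v + 1) + s + 2) ≤ B * (5 * B) := Nat.mul_le_mul hD (by omega)
    have h3 : 16 * (B * B) ≤ B * (B * B) := Nat.mul_le_mul_right _ hB
    have h4 : B ^ 3 = B * (B * B) := by ring
    nlinarith
  have h2 : F ≤ B ^ 6 := by
    have ha : 2 ^ L * (2 ^ L * (s' + 6) + 3) ≤ B * (B * B ^ 3 + 3) := by gcongr
    have hb : F ≤ B * (B * B ^ 3 + 3) + B ^ 3 := by omega
    have hp : B ≤ B ^ 5 := Nat.le_self_pow (by norm_num) B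
    have hp3 : B ^ 3 ≤ B ^ 5 := Nat.pow_le_pow_right (by omega) (by norm_num)
    have h5 : 16 * B ^ 5 ≤ B * B ^ 5 := Nat.mul_le_mul_right _ hB
    have e1 : B * (B * B ^ 3 + 3) = B ^ 5 + 3 * B := by ring
    have e2 : B ^ 6 = B * B ^ 5 := by ring
    omega
  have h3 : 9 * v + (L * (F + v) + 1) + 2 ≤ B ^ 8 := by
    have ha : L * (F + v) ≤ B * (B ^ 6 + B) := Nat.mul_le_mul hLB (by omega)
    have hp : B ≤ B ^ 7 := Nat.le_self_pow (by norm_num) B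
    have hp2 : B ^ 2 ≤ B ^ 7 := Nat.pow_le_pow_right (by omega) (by norm_num)
    have h5 : 16 * B ^ 7 ≤ B * B ^ 7 := Nat.mul_le_mul_right _ hB
    have e1 : B * (B ^ 6 + B) = B ^ 7 + B ^ 2 := by ring
    have e2 : B ^ 8 = B * B ^ 7 := by ring
    omega
  have h4 : (D * (2 ^ L + 1) + 1) ^ L ≤ B ^ (3 * L) := by
    rw [pow_mul]
    gcongr
    have ha : D * (2 ^ L + 1) ≤ B * (B + 1) := Nat.mul_le_mul (by omega) (by omega)
    have h5 : 16 * B ^ 2 ≤ B * B ^ 2 := Nat.mul_le_mul_right _ hB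
    nlinarith
  have hx : 1 ≤ B ^ (3 * L) := Nat.one_le_pow _ _ (by omega)
  have hy : 1 ≤ B ^ 8 := Nat.one_le_pow _ _ (by omega)
  have e3 : B ^ (3 * L + 11) = B ^ (3 * L) * B ^ 8 * B ^ 3 := by ring
  have h16 : 3 ≤ B ^ 3 := by
    have : B ≤ B ^ 3 := Nat.le_self_pow (by norm_num) B
    omega
  calc _ ≤ (B ^ (3 * L) + B ^ (3 * L)) * B ^ 8 + B ^ (3 * L) * B ^ 8 := by
        gcongr
        exact Nat.one_le_iff_ne_zero.mpr (by positivity)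
    _ = B ^ (3 * L) * B ^ 8 * 3 := by ring
    _ ≤ _ := by rw [e3]; gcongr

theorem eventually_pow_add_one_le_two_pow (b : ℕ) : ∀ᶠ n : ℕ in atTop, (n + 1) ^ b + 1 ≤ 2 ^ n := by
  have h := (tendsto_pow_const_div_const_pow_of_one_lt b (one_lt_two : (1 : ℝ) < 2)).comp
    (tendsto_add_atTop_nat 1)
  filter_upwards [h.eventually (gt_mem_nhds (show (0 : ℝ) < 1 / 4 by norm_num)),
    eventually_ge_atTop 1] with n hn hn1
  simp only [Function.comp] at hn
  rw [div_lt_iff₀ (by positivity), pow_succ (2 : ℝ) n] at hn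
  have h2 : (2 : ℝ) ^ 1 ≤ 2 ^ n := pow_le_pow_right₀ one_le_two hn1
  have h3 : ((n + 1 : ℕ) : ℝ) ^ b + 1 ≤ 2 ^ n := by linarith
  exact_mod_cast h3

/-- The number w of coordinates forces the quadratic exponent. A permanent in few variables costs
2^{O(n)}, and fixed powers of N add only exponents linear in n. -/
theorem annihilator_size_bounds {n a k m N w K : ℕ} (hn : 4 ≤ n) (hm2 : m + 1 ≤ 2 ^ n)
    (hN2 : N ≤ 2 ^ (2 * n)) (hcard : w ≤ 2 ^ (n * n)) (hK : K = 2 * a + 2 * k + 5) :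
    16 ≤ 2 ^ (K * n ^ 2) ∧ N ^ a * (m + 1) + 1 ≤ 2 ^ (K * n ^ 2) ∧ m * m + 1 ≤ 2 ^ (K * n ^ 2) ∧
      w * (2 ^ n * (n + 3) + 1) + N ^ k ≤ 2 ^ (K * n ^ 2) ∧ 2 ^ n ≤ 2 ^ (K * n ^ 2) := by
  have hnsq : n ≤ n ^ 2 := Nat.le_self_pow two_ne_zero n
  refine ⟨?_, ?_, ?_, ?_, ?_⟩
  · calc 16 = 2 ^ 4 := by norm_num
      _ ≤ 2 ^ (K * n ^ 2) := Nat.pow_le_pow_right two_pos (by nlinarith)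
  · calc N ^ a * (m + 1) + 1 ≤ (2 ^ (2 * n)) ^ a * 2 ^ n + (2 ^ (2 * n)) ^ a * 2 ^ n := by
          gcongr
          exact Nat.one_le_iff_ne_zero.mpr (by positivity)
      _ = 2 ^ (2 * n * a + n + 1) := by rw [pow_succ, pow_add, ← pow_mul]; ring
      _ ≤ 2 ^ (K * n ^ 2) := Nat.pow_le_pow_right two_pos (by
          refine le_trans ?_ (Nat.mul_le_mul_left K hnsq)
          rw [hK]
          nlinarith)
  · calc m * m + 1 ≤ (m + 1) * (m + 1) := by nlinarith
      _ ≤ 2 ^ n * 2 ^ n := Nat.mul_le_mul hm2 hm2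
      _ = 2 ^ (n + n) := (pow_add _ _ _).symm
      _ ≤ 2 ^ (K * n ^ 2) := Nat.pow_le_pow_right two_pos (by
          refine le_trans ?_ (Nat.mul_le_mul_left K hnsq)
          rw [hK]
          nlinarith)
  · have hn2n : n + 1 ≤ 2 ^ n := Nat.lt_two_pow_self
    have hr : 2 ^ n * (n + 3) + 1 ≤ 2 ^ (2 * n + 2) := by
      have e : 2 ^ (2 * n + 2) = 2 ^ n * (4 * 2 ^ n) := by ring
      rw [e]
      have : 2 ^ n * (n + 4) ≤ 2 ^ n * (4 * 2 ^ n) := by gcongr; omega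
      nlinarith
    have hNk : N ^ k ≤ 2 ^ (2 * n * k) := by
      rw [pow_mul]
      gcongr
    calc w * (2 ^ n * (n + 3) + 1) + N ^ k
        ≤ 2 ^ (n * n) * 2 ^ (2 * n + 2) + 2 ^ (2 * n * k) :=
          Nat.add_le_add (Nat.mul_le_mul hcard hr) hNk
      _ = 2 ^ (n * n + 2 * n + 2) + 2 ^ (2 * n * k) := by ring
      _ ≤ 2 ^ (n * n + 2 * n + 2 + 2 * n * k) + 2 ^ (n * n + 2 * n + 2 + 2 * n * k) :=
          Nat.add_le_add (Nat.pow_le_pow_right two_pos (by omega))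
            (Nat.pow_le_pow_right two_pos (by omega))
      _ = 2 ^ (n * n + 2 * n + 2 + 2 * n * k + 1) := by rw [pow_succ _ (_ + 2 * n * k)]; ring
      _ ≤ 2 ^ (K * n ^ 2) := Nat.pow_le_pow_right two_pos (by
          have h1 : 2 * k * n ≤ 2 * k * n ^ 2 := Nat.mul_le_mul_left _ hnsq
          have h2 : K * n ^ 2 = 2 * k * n ^ 2 + 5 * n ^ 2 + 2 * a * n ^ 2 := by rw [hK]; ring
          nlinarith)
  · exact Nat.pow_le_pow_right two_pos (by
      refine le_trans hnsq (Nat.le_mul_of_pos_left _ (by omega)))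

/-- An equation for the slice of `VNP` with small degree and a small circuit yields a circuit for the
permanent. -/
theorem eventually_hasCircuitOfSize_permPoly (b : ℕ) : ∃ c : ℕ, ∀ a k : ℕ, ∀ᶠ n : ℕ in atTop,
    ∀ m d N : ℕ, m ≤ (n + 1) ^ b → d ≤ n → N = (n + d).choose n →
      ∀ P : MvPolynomial (MonIdx n d) ℂ, P ≠ 0 → P.totalDegree ≤ N ^ a →
        HasCircuitOfSize P (N ^ k) → (∀ f ∈ VNPSlice ℂ c n d, VanishesAt P f) →
          ∃ t < 2 ^ n ^ 4, HasCircuitOfSize (permPoly ℂ m) t := by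
  -- Here n^(4b+4) is the base B that bounds m, q and n² + n + 1, and 22 is the exponent in
  -- `exists_boolSum_eq_sum_permanent`.
  refine ⟨(4 * b + 4) * 22, fun a k => ?_⟩
  -- With K = 2a + 2k + 5 the final exponent is at most 14Kn³, so n > 14K brings it below n⁴.
  filter_upwards [eventually_ge_atTop (14 * (2 * a + 2 * k + 5) + 4),
    eventually_pow_add_one_le_two_pow b] with n hn hpow m d N hmb hdn hN P hP hPdeg hPsize hvan
  have hn4 : 4 ≤ n := by omega
  have hm2 : m + 1 ≤ 2 ^ n := by omega
  -- Bertrand's postulate: q exceeds m², for distinct evaluation points at all positions, and n, for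
  -- exponents to stay distinct modulo q, yet remains polynomial in n.
  obtain ⟨q, hqp, hq1, hq2⟩ := Nat.exists_prime_lt_and_le_two_mul (m * m + n + 1) (by omega)
  have : Fact q.Prime := ⟨hqp⟩
  have : Fintype (MonIdx n d) := Fintype.ofFinite _
  classical
  have hnp : ∀ j, 1 ≤ n ^ j := fun j => Nat.one_le_pow _ _ (by omega)
  have hm' : m ≤ n ^ (2 * b) := by
    refine hmb.trans ?_
    rw [pow_mul]
    gcongr
    nlinarith
  have hB : ∀ x, x ≤ 6 * (n ^ (4 * b) * n ^ 2) → x ≤ n ^ (4 * b + 4) := by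
    intro x hx
    refine hx.trans ?_
    have : n ^ (4 * b + 4) = n ^ 2 * (n ^ (4 * b) * n ^ 2) := by ring
    rw [this]
    gcongr
    nlinarith
  have hmm : m * m ≤ n ^ (4 * b) := by
    calc m * m ≤ n ^ (2 * b) * n ^ (2 * b) := Nat.mul_le_mul hm' hm'
      _ = n ^ (4 * b) := by ring
  have hn2 : n * n + n + 1 ≤ 3 * n ^ 2 := by nlinarith
  have hn3 : n + 1 ≤ 2 * n ^ 2 := by nlinarith
  have hprod1 : n ^ 2 ≤ n ^ (4 * b) * n ^ 2 := Nat.le_mul_of_pos_left _ (hnp _)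
  have hprod2 : n ^ (4 * b) ≤ n ^ (4 * b) * n ^ 2 := Nat.le_mul_of_pos_right _ (hnp _)
  obtain ⟨c⟩ : Nonempty (Fin m × Fin m ↪ ZMod q) := by
    refine Function.Embedding.nonempty_of_card_le ?_
    rw [Fintype.card_prod, Fintype.card_fin, ZMod.card]
    omega
  let h : MonIdx n d → Fin m × Fin m → ZMod q := fun e p => ∑ l, (e.1 l : ZMod q) * c p ^ (l : ℕ)
  obtain ⟨Q, hQ0, hQroot, hQdeg, hQsize⟩ := exists_annihilator_of_permanent (r := n) h
    (fun e e' hne => card_agree_le c c.injective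
      (fun l => by have := le_of_monIdx e l; omega) (fun l => by have := le_of_monIdx e' l; omega)
      fun heq => hne (Subtype.ext (DFunLike.coe_injective heq))) hP hPdeg hPsize (by
      intro α
      obtain ⟨f, hf, hcoeff⟩ := exists_mem_VNPSlice (B := n ^ (4 * b + 4)) (q := q)
        (c₀ := (4 * b + 4) * 22) (m := m)
        (hB 4 (by nlinarith [hnp (4 * b)])) hdn (hB _ (by omega)) (hB _ (by nlinarith))
        (hB q (by omega)) (by rw [← pow_mul]) (fun i j => c (i, j)) α
      have := hvan f hf
      rw [VanishesAt, funext hcoeff] at this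
      exact this)
  have hN2 : N ≤ 2 ^ (2 * n) := by
    rw [hN]
    exact (Nat.choose_le_two_pow _ _).trans (Nat.pow_le_pow_right two_pos (by omega))
  set K := 2 * a + 2 * k + 5 with hK
  have hcard : Fintype.card (MonIdx n d) ≤ 2 ^ (n * n) := by
    refine (card_monIdx_le n d).trans ?_
    have hn2n : d + 1 ≤ 2 ^ n := (Nat.succ_le_succ hdn).trans Nat.lt_two_pow_self
    rw [pow_mul]
    gcongr
  obtain ⟨h16, hbD, hbv, hbs, hbL⟩ := annihilator_size_bounds hn4 hm2 hN2 hcard hK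
  have hroot := hasCircuitOfSize_root (L := n) (m := m) hQ0 hQroot hQdeg hQsize
    (totalDegree_permanent_le fun i j => by simp) hm2 rfl rfl
  refine ⟨_, lt_of_le_of_lt (root_size_bound (B := 2 ^ (K * n ^ 2)) ?_ ?_ ?_ ?_ ?_ rfl rfl) ?_,
    hroot⟩
  · exact h16
  · exact hbD
  · rwa [Fintype.card_prod, Fintype.card_fin]
  · exact hbs
  · exact hbL
  · rw [← pow_mul]
    refine Nat.pow_lt_pow_right one_lt_two ?_
    calc K * n ^ 2 * (3 * n + 11) ≤ K * n ^ 2 * (14 * n) := Nat.mul_le_mul_left _ (by omega)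
      _ = 14 * K * n ^ 3 := by ring
      _ < n * n ^ 3 := Nat.mul_lt_mul_of_pos_right (by omega) (hnp 3)
      _ = n ^ 4 := by ring

end Bounds

/-! ### Hardness of the permanent, slices and families. -/

section Main

open Filter

theorem tendsto_numVars {ε : ℝ} (hε : 0 < ε) : Tendsto (numVars ε) atTop atTop :=
  tendsto_nat_floor_atTop.comp
    ((tendsto_rpow_atTop (by positivity)).comp tendsto_natCast_atTop_atTop)

/-- Since m is polynomial in n with exponent depending on ε only, so is the bound defining the
slice. -/
theorem le_numVars_add_one_pow {ε : ℝ} (hε : 0 < ε) (m : ℕ) :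
    m ≤ (numVars ε m + 1) ^ ⌈4 / ε⌉₊ := by
  have h1 : (m : ℝ) ^ (ε / 4) ≤ (numVars ε m : ℝ) + 1 := (Nat.lt_floor_add_one _).le
  have h2 : (m : ℝ) = ((m : ℝ) ^ (ε / 4)) ^ (4 / ε) := by
    rw [← Real.rpow_mul (Nat.cast_nonneg m)]
    rw [show ε / 4 * (4 / ε) = 1 by field_simp, Real.rpow_one]
  have h3 : (m : ℝ) ≤ ((numVars ε m : ℝ) + 1) ^ ⌈4 / ε⌉₊ := by
    rw [h2]
    calc ((m : ℝ) ^ (ε / 4)) ^ (4 / ε) ≤ ((numVars ε m : ℝ) + 1) ^ (4 / ε) :=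
          Real.rpow_le_rpow (by positivity) h1 (by positivity)
      _ ≤ ((numVars ε m : ℝ) + 1) ^ (⌈4 / ε⌉₊ : ℝ) :=
          Real.rpow_le_rpow_of_exponent_le (by linarith [(Nat.cast_nonneg (numVars ε m) : (0:ℝ) ≤ _)])
            (Nat.le_ceil _)
      _ = _ := Real.rpow_natCast _ _
  exact_mod_cast h3

/-- This is why the exponent is ε/4: the hardness bound is at least 2^{n⁴}, against a circuit of
size 2^{O(n³)}. -/
theorem numVars_pow_four_le {ε : ℝ} (m : ℕ) : ((numVars ε m : ℝ)) ^ 4 ≤ (m : ℝ) ^ ε := by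
  have h1 : (numVars ε m : ℝ) ≤ (m : ℝ) ^ (ε / 4) := Nat.floor_le (by positivity)
  calc (numVars ε m : ℝ) ^ 4 ≤ ((m : ℝ) ^ (ε / 4)) ^ 4 := by gcongr
    _ = (m : ℝ) ^ ε := by
      rw [← Real.rpow_natCast, ← Real.rpow_mul (Nat.cast_nonneg m)]
      congr 1
      push_cast
      ring

theorem PermHard.two_pow_le {ε : ℝ} {m t : ℕ} (h : PermHard ε m)
    (ht : HasCircuitOfSize (permPoly ℂ m) t) : 2 ^ numVars ε m ^ 4 ≤ t := by
  obtain ⟨C, hC, hs⟩ := ht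
  have h1 := h C hC
  have h2 : (2 : ℝ) ^ (((numVars ε m ^ 4 : ℕ) : ℝ)) ≤ (2 : ℝ) ^ ((m : ℝ) ^ ε) :=
    Real.rpow_le_rpow_of_exponent_le one_le_two (by exact_mod_cast numVars_pow_four_le m)
  rw [Real.rpow_natCast] at h2
  have h3 := (h2.trans h1).trans (Nat.cast_le.mpr hs)
  exact_mod_cast h3

/-- Equations for a suitable slice of `VNP` require large circuits when the permanent is hard. -/
theorem exists_slice_equations_require_size {ε : ℝ} (hε : 0 < ε) :
    ∃ c : ℕ, ∀ a k : ℕ, ∀ᶠ m : ℕ in atTop, PermHard ε m →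
      ∀ n d N : ℕ, n = numVars ε m → d ≤ n → N = (n + d).choose n →
        ∀ P : MvPolynomial (MonIdx n d) ℂ, P ≠ 0 → P.totalDegree ≤ N ^ a →
          (∀ f ∈ VNPSlice ℂ c n d, VanishesAt P f) →
            RequiresSize P ((N : ℝ) ^ k) := by
  obtain ⟨c, hc⟩ := eventually_hasCircuitOfSize_permPoly ⌈4 / ε⌉₊
  refine ⟨c, fun a k => ?_⟩
  filter_upwards [(tendsto_numVars hε).eventually (hc a k)] with m hm hhard n d N hn hd hN P hP
    hdeg hvan C hC
  subst hn
  by_contra! hlt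
  have hlt' : C.size < N ^ k := by exact_mod_cast hlt
  obtain ⟨t, ht, hperm⟩ := hm m d N (le_numVars_add_one_pow hε m) hd hN P hP hdeg
    ⟨C, hC, hlt'.le⟩ hvan
  exact absurd (hhard.two_pow_le hperm) (not_le.mpr ht)

/-- Non-vanishing points in the slices for infinitely many `m` can be collected into one family in
`VNP`. -/
theorem eventually_vanishesAt_slice {ε : ℝ} (hε : 0 < ε) (c : ℕ) (d : ℕ → ℕ)
    (P : (m : ℕ) → MvPolynomial (MonIdx (numVars ε m) (d m)) ℂ)
    (hP : ∀ f : (n : ℕ) → MvPolynomial (Fin n) ℂ, MemVNP f →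
      ∀ᶠ m : ℕ in atTop, PermHard ε m →
        (f (numVars ε m)).totalDegree ≤ d m → VanishesAt (P m) (f (numVars ε m))) :
    ∀ᶠ m : ℕ in atTop, PermHard ε m →
      ∀ f ∈ VNPSlice ℂ c (numVars ε m) (d m), VanishesAt (P m) f := by
  by_contra hcon
  rw [not_eventually] at hcon
  -- Several m may share the same n, so one bad m is chosen per n, and the zero polynomial if there
  -- is none. Quantifying over F with `F n = boolSum g` avoids transport along `numVars ε m = n`.
  have key : ∀ n : ℕ, ∃ (k : ℕ) (g : MvPolynomial (Fin n ⊕ Fin k) ℂ),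
      (1 ≤ n → k ≤ n ^ c ∧ g.totalDegree ≤ n ^ c ∧ HasCircuitOfSize g (n ^ c)) ∧
      ((∃ m, numVars ε m = n ∧ ¬(PermHard ε m →
        ∀ f ∈ VNPSlice ℂ c (numVars ε m) (d m), VanishesAt (P m) f)) →
        ∃ m, numVars ε m = n ∧ PermHard ε m ∧ ∀ F : (n : ℕ) → MvPolynomial (Fin n) ℂ,
          F n = boolSum g → (F (numVars ε m)).totalDegree ≤ d m ∧
            ¬VanishesAt (P m) (F (numVars ε m))) := by
    intro n
    by_cases hn : ∃ m, numVars ε m = n ∧ ¬(PermHard ε m →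
        ∀ f ∈ VNPSlice ℂ c (numVars ε m) (d m), VanishesAt (P m) f)
    · obtain ⟨m, rfl, hm⟩ := hn
      push Not at hm
      obtain ⟨hhard, f, ⟨hdeg, k, g, hk, hgd, hgs, rfl⟩, hne⟩ := hm
      exact ⟨k, g, fun _ => ⟨hk, hgd, hgs⟩, fun _ => ⟨m, rfl, hhard, fun F hF => by
        rw [hF]; exact ⟨hdeg, hne⟩⟩⟩
    · refine ⟨0, MvPolynomial.C 0, fun h1 => ⟨Nat.zero_le _, by simp, ?_⟩, fun h => absurd h hn⟩
      exact (hasCircuitOfSize_C 0).mono (Nat.one_le_pow _ _ h1)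
  choose k g hbound hg using key
  have hmem : MemVNP fun n => boolSum (g n) := by
    refine ⟨k, g, ⟨c, ?_⟩, ⟨c, ?_⟩, fun n => rfl⟩
    · filter_upwards [eventually_ge_atTop 1] with n hn using (hbound n hn).2
    · filter_upwards [eventually_ge_atTop 1] with n hn using (hbound n hn).1
  obtain ⟨M, hM⟩ := eventually_atTop.mp (hP _ hmem)
  -- The m chosen for this n may differ from m₀. Taking n above all values of `numVars ε` on m < M
  -- forces it to be at least M.
  obtain ⟨m₀, hm₀, hlarge⟩ := (hcon.and_eventually ((tendsto_numVars hε).eventually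
    (eventually_gt_atTop ((Finset.range M).sup (numVars ε))))).exists
  obtain ⟨m, hmn, hhard, hF⟩ := hg (numVars ε m₀) ⟨m₀, rfl, hm₀⟩
  obtain ⟨hdeg, hne⟩ := hF (fun n => boolSum (g n)) rfl
  refine hne (hM m ?_ hhard hdeg)
  by_contra! hlt
  have := Finset.le_sup (f := numVars ε) (Finset.mem_range.mpr hlt)
  omega

end Main

end VNPEquations

open VNPEquations Filter in
/-- The first part is the statement for each large `m` for which `Perm_m` is hard, with `VNP(n, d)`
cut off at a polynomial bound `n ^ c` whose exponent depends on `ε` only. The second part is the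
statement for families `(P_m)` against families in `VNP`. In both, `size(P) = N ^ ω(1)` is asserted
as `size(P) ≥ N ^ k` for every `k` and all large `m`, for `P` of degree polynomial in `N`. -/
theorem theorem1p2 (ε : ℝ) (hε : 0 < ε) :
    (∃ c : ℕ, ∀ a k : ℕ, ∀ᶠ m : ℕ in atTop, PermHard ε m →
      ∀ n d N : ℕ, n = numVars ε m → d ≤ n → N = (n + d).choose n →
        ∀ P : MvPolynomial (MonIdx n d) ℂ, P ≠ 0 → P.totalDegree ≤ N ^ a →
          (∀ f ∈ VNPSlice ℂ c n d, VanishesAt P f) →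
            RequiresSize P ((N : ℝ) ^ k)) ∧
    (∀ (d : ℕ → ℕ) (P : (m : ℕ) → MvPolynomial (MonIdx (numVars ε m) (d m)) ℂ) (a : ℕ),
      (∀ m, d m ≤ numVars ε m) →
      (∀ m, P m ≠ 0) →
      (∀ᶠ m : ℕ in atTop, (P m).totalDegree ≤ ((numVars ε m + d m).choose (numVars ε m)) ^ a) →
      (∀ f : (n : ℕ) → MvPolynomial (Fin n) ℂ, MemVNP f →
        ∀ᶠ m : ℕ in atTop, PermHard ε m →
          (f (numVars ε m)).totalDegree ≤ d m → VanishesAt (P m) (f (numVars ε m))) →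
      ∀ k : ℕ, ∀ᶠ m : ℕ in atTop, PermHard ε m →
        RequiresSize (P m) ((((numVars ε m + d m).choose (numVars ε m) : ℕ) : ℝ) ^ k)) := by
  obtain ⟨c, hc⟩ := exists_slice_equations_require_size hε
  refine ⟨⟨c, hc⟩, fun d P a hd hP0 hdeg hvan k => ?_⟩
  filter_upwards [hc a k, hdeg, eventually_vanishesAt_slice hε c d P hvan] with m hm hdm hv hhard
  exact hm hhard _ _ _ rfl (hd m) rfl (P m) (hP0 m) hdm (hv hhard)
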